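/- A pushdown automaton (PDA) is a tuple $\mathcal P=(Q,\Sigma,\Gamma,\delta)$ with finite sets $Q$ of states, $\Sigma$ of input letters and $\Gamma$ of stack symbols, and a finite transition relation $\delta\subseteq (Q\times\Sigma\times\Gamma)\times(Q\times\Gamma^*)$; a transition $(p,a,A,q,\gamma)$ pops $A$ and pushes $\gamma$. There is a symbol $\bot\in\Gamma$ such that every transition that pops $\bot$ pushes a word ending in $\bot$. $\mathcal P$ is deterministic if for all $(p,a,A)\in Q\times\Sigma\times\Gamma$ there is exactly one $(q,\gamma)$ with $(p,a,A,q,\gamma)\in\delta$. Its size is $|\mathcal P|=|Q|+|\Sigma|+|\Gamma|+\sum_{(p,a,A,q,\gamma)\in\delta}(4+|\gamma|)$. A pseudo-configuration is a pair $(S,\gamma)$ with $S\subseteq Q$ and $\gamma\in\Gamma^*$. For $a\in\Sigma$, its successors $\mathrm{Succ}(S,A\eta,a)$ are obtained as follows: partition the transitions $(p,a,A,q,\gamma)\in\delta$ with $p\in S$ into classes according to the pushed word $\gamma$; each class $E$, with pushed word $\gamma$, yields the successor $(\{q : (p,a,A,q,\gamma)\in E\},\gamma\eta)$. A super-synchroniser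 between $(I,\bot)$ and $s\in Q$ is a finite tree whose vertices are labelled by pseudo-configurations such that the root is labelled $(I,\bot)$, every leaf is labelled $(\{s\},\bot)$, and every inner vertex is labelled by some $(S,A\eta)$ and, for some $a\in\Sigma$, has exactly one child for each element of $\mathrm{Succ}(S,A\eta,a)$, labelled by that element. **Theorem.** There are an algorithm and a constant $c$ such that, given a deterministic PDA $\mathcal P$, a subset $I\subseteq Q$ and a state $s\in Q$, the algorithm decides whether there is a super-synchroniser between $(I,\bot)$ and $s$ in time $O\bigl(n^{4ck^3}\bigr)$, where $n=|\mathcal P|$ and $k=|I|$; neither $c$ nor the constant in the $O$ depends on the input. Hence this algorithm runs in time polynomial in $n$ on the instances with $|I|=k$, for each fixed $k$, and in quasi-polynomial time $2^{O((\log n)^{e})}$ with a constant $e$ on the instances with $|I|\le b\log n$, for each fixed $b$. Here time is the number of steps of a program in a fixed imperative language over binary trees with unit-cost operations (cons, head, tail, test for the empty tree), a model that is polynomially equivalent to multi-tape Turing machines; numbers are encoded in unary in the input. -/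

import Mathlib

/-! ## Pushdown automata -/

/-- A transition `(src, inp, top, tgt, push)`: in state `src`, on input `inp`, with `top` on top of
the stack, pop `top`, push the word `push` (its first letter becomes the top), go to `tgt`. -/
structure Transition (Q Inp Stk : Type) where
  src : Q
  inp : Inp
  top : Stk
  tgt : Q
  push : List Stk

/-- A pushdown automaton with states `Q`, input alphabet `Inp` and stack alphabet `Stk`, with a
bottom-of-stack symbol that is pushed back in the bottom-most position whenever it is popped. -/
structure PDA (Q Inp Stk : Type) where
  δ : Finset (Transition Q Inp Stk)
  bot : Stk
  bot_push : ∀ t ∈ δ, t.top = bot → ∃ γ : List Stk, t.push = γ ++ [bot]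

namespace PDA

variable {Q Inp Stk : Type}

/-- Exactly one transition for every state, input letter and stack symbol. -/
def Deterministic (P : PDA Q Inp Stk) : Prop :=
  ∀ (p : Q) (a : Inp) (A : Stk), ∃! t, t ∈ P.δ ∧ t.src = p ∧ t.inp = a ∧ t.top = A

/-- The size `|P|`: the number of states, letters and stack symbols, plus the total length of the
transitions `(p, a, A, q, γ)` written as words over these. -/
def size [Fintype Q] [Fintype Inp] [Fintype Stk] (P : PDA Q Inp Stk) : ℕ :=
  Fintype.card Q + Fintype.card Inp + Fintype.card Stk + ∑ t ∈ P.δ, (4 + t.push.length)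

/-- The set of transitions that can occur from a state of `S` on input `a` with top symbol `A`. -/
def trans (P : PDA Q Inp Stk) (S : Set Q) (a : Inp) (A : Stk) : Set (Transition Q Inp Stk) :=
  {t | t ∈ P.δ ∧ t.src ∈ S ∧ t.inp = a ∧ t.top = A}

/-- Two such transitions are indistinguishable for the observer if they push the same word. -/
def indist (P : PDA Q Inp Stk) (S : Set Q) (a : Inp) (A : Stk) : Setoid (P.trans S a A) where
  r t₁ t₂ := ∃ γ : List Stk, t₁.1.push = γ ∧ t₂.1.push = γ
  iseqv :=
    ⟨fun _ => ⟨_, rfl, rfl⟩, fun ⟨γ, h₁, h₂⟩ => ⟨γ, h₂, h₁⟩,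
      fun ⟨γ, h₁, h₂⟩ ⟨_, h₃, h₄⟩ => ⟨γ, h₁, h₄.trans (h₃.symm.trans h₂)⟩⟩

/-- The states that a class `E` of transitions leads to. -/
def next {T : Set (Transition Q Inp Stk)} (E : Set T) : Set Q :=
  {q | ∃ t ∈ E, t.1.tgt = q}

/-- A pseudo-configuration: a set of states (the knowledge of the observer) and a stack content. -/
abbrev PseudoConf (Q Stk : Type) : Type := Set Q × List Stk

/-- The possible successors of the pseudo-configuration `(S, A :: η)` on input `a`: one for each
class `E` of indistinguishable transitions, where `γ` is the word pushed by the members of `E`. -/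
def succ (P : PDA Q Inp Stk) (S : Set Q) (A : Stk) (η : List Stk) (a : Inp) :
    Set (PseudoConf Q Stk) :=
  {c | ∃ E ∈ (P.indist S a A).classes, ∃ γ : List Stk,
    (∀ t ∈ E, t.1.push = γ) ∧ c = (next E, γ ++ η)}

/-- The synchronisers between a pseudo-configuration and the state `s`, as finite labelled trees;
the index is the label of the root. A leaf is labelled `({s}, η)`. An inner vertex labelled
`(S, A :: η)` carries the common input letter `a` of its outgoing edges, and has one child for each
possible successor, labelled by it; it has at least one child, as it would be a leaf otherwise. -/
inductive Synchroniser (P : PDA Q Inp Stk) (s : Q) : PseudoConf Q Stk → Type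
  | leaf (η : List Stk) : Synchroniser P s ({s}, η)
  | node (S : Set Q) (A : Stk) (η : List Stk) (a : Inp) (hne : (P.succ S A η a).Nonempty)
      (child : ∀ c : P.succ S A η a, Synchroniser P s c.1) : Synchroniser P s (S, A :: η)

/-- All leaves are labelled `({s}, ⊥)`. -/
def Synchroniser.IsSuper {P : PDA Q Inp Stk} {s : Q} :
    {c : PseudoConf Q Stk} → Synchroniser P s c → Prop
  | _, .leaf η => η = [P.bot]
  | _, .node _ _ _ _ _ child => ∀ c, (child c).IsSuper

/-- There is a super-synchroniser between `(I, γ)` and `s`. -/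
def SuperSync (P : PDA Q Inp Stk) (I : Set Q) (γ : List Stk) (s : Q) : Prop :=
  ∃ T : Synchroniser P s (I, γ), T.IsSuper

end PDA

/-- An instance `(P, I, s)` of the problem: a deterministic pushdown automaton with finite sets of
states, input letters and stack symbols, a set `I` of states and a state `s`. -/
structure DetInstance where
  Q : Type
  Inp : Type
  Stk : Type
  [fintypeQ : Fintype Q]
  [fintypeInp : Fintype Inp]
  [fintypeStk : Fintype Stk]
  P : PDA Q Inp Stk
  det : P.Deterministic
  I : Finset Q
  s : Q

attribute [instance] DetInstance.fintypeQ DetInstance.fintypeInp DetInstance.fintypeStk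

/-! ## The machine model

Imperative `while` programs over finite binary trees (a pure Lisp, or pointer machine): finitely
many variables hold trees, and the primitive operations `cons`, `hd`, `tl` and the test for `nil`
have unit cost. A step creates at most one new cell per `cons` in the fixed program text, so this
model and the multi-tape Turing machine simulate each other with polynomial overhead. -/

/-- Binary trees. -/
inductive Data where
  | nil : Data
  | cons : Data → Data → Data

namespace Data

/-- The left subtree (`nil` for `nil`). -/
def hd : Data → Data
  | nil => nil
  | cons x _ => x

/-- The right subtree (`nil` for `nil`). -/
def tl : Data → Data
  | nil => nil
  | cons _ y => y

/-- A list of trees as a tree. -/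
def ofList : List Data → Data
  | [] => nil
  | x :: l => cons x (ofList l)

/-- A number in unary. -/
def ofNat : ℕ → Data
  | 0 => nil
  | n + 1 => cons nil (ofNat n)

end Data

/-- Expressions over the variables `0, 1, 2, …`. -/
inductive Expr where
  | var : ℕ → Expr
  | nil : Expr
  | cons : Expr → Expr → Expr
  | hd : Expr → Expr
  | tl : Expr → Expr

/-- A store: the values of the variables. -/
abbrev Store : Type := ℕ → Data

namespace Expr

/-- The value of an expression. -/
def eval (σ : Store) : Expr → Data
  | var i => σ i
  | nil => Data.nil
  | cons e f => Data.cons (e.eval σ) (f.eval σ)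
  | hd e => (e.eval σ).hd
  | tl e => (e.eval σ).tl

/-- The number of steps needed to evaluate an expression: one for each symbol in it. -/
def cost : Expr → ℕ
  | var _ => 1
  | nil => 1
  | cons e f => e.cost + f.cost + 1
  | hd e => e.cost + 1
  | tl e => e.cost + 1

end Expr

/-- Programs. -/
inductive Prog where
  | assign : ℕ → Expr → Prog
  | seq : Prog → Prog → Prog
  | ite : Expr → Prog → Prog → Prog
  | while : Expr → Prog → Prog

/-- `Run p σ σ' t`: started in the store `σ`, the (deterministic) program `p` halts after exactly
`t` steps in the store `σ'`. A test succeeds if the value of its expression is not `nil`. -/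
inductive Run : Prog → Store → Store → ℕ → Prop
  | assign (i : ℕ) (e : Expr) (σ : Store) :
      Run (.assign i e) σ (Function.update σ i (e.eval σ)) (e.cost + 1)
  | seq {p q : Prog} {σ₁ σ₂ σ₃ : Store} {t u : ℕ} (h₁ : Run p σ₁ σ₂ t) (h₂ : Run q σ₂ σ₃ u) :
      Run (.seq p q) σ₁ σ₃ (t + u)
  | ite_true {e : Expr} {p q : Prog} {σ σ' : Store} {t : ℕ} (he : e.eval σ ≠ Data.nil)
      (h : Run p σ σ' t) : Run (.ite e p q) σ σ' (e.cost + 1 + t)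
  | ite_false {e : Expr} {p q : Prog} {σ σ' : Store} {t : ℕ} (he : e.eval σ = Data.nil)
      (h : Run q σ σ' t) : Run (.ite e p q) σ σ' (e.cost + 1 + t)
  | while_true {e : Expr} {p : Prog} {σ₁ σ₂ σ₃ : Store} {t u : ℕ} (he : e.eval σ₁ ≠ Data.nil)
      (h₁ : Run p σ₁ σ₂ t) (h₂ : Run (.while e p) σ₂ σ₃ u) :
      Run (.while e p) σ₁ σ₃ (e.cost + 1 + t + u)
  | while_false {e : Expr} {p : Prog} {σ : Store} (he : e.eval σ = Data.nil) :
      Run (.while e p) σ σ (e.cost + 1)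

/-- The initial store on input `d`: variable `0` holds `d`, all others hold `nil`. -/
def inputStore (d : Data) : Store := fun i => if i = 0 then d else Data.nil

/-! ## Inputs and running times -/

namespace DetInstance

/-- `x.Encodes d`: the tree `d` presents the instance `x`, with the states, letters and stack
symbols numbered in some order, and the members of `I` and of the transition relation listed
without repetition in some order. -/
def Encodes (x : DetInstance) (d : Data) : Prop :=
  ∃ (nQ : x.Q ≃ Fin (Fintype.card x.Q)) (nInp : x.Inp ≃ Fin (Fintype.card x.Inp))
    (nStk : x.Stk ≃ Fin (Fintype.card x.Stk)) (lI : List x.Q)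
    (lδ : List (Transition x.Q x.Inp x.Stk)),
    lI.Nodup ∧ (∀ q, q ∈ lI ↔ q ∈ x.I) ∧ lδ.Nodup ∧ (∀ t, t ∈ lδ ↔ t ∈ x.P.δ) ∧
    d = Data.ofList
      [Data.ofList (lI.map fun q => Data.ofNat (nQ q)),
        Data.ofNat (nQ x.s),
        Data.ofNat (nStk x.P.bot),
        Data.ofNat (Fintype.card x.Q),
        Data.ofNat (Fintype.card x.Inp),
        Data.ofNat (Fintype.card x.Stk),
        Data.ofList (lδ.map fun t => Data.ofList
          [Data.ofNat (nQ t.src), Data.ofNat (nInp t.inp), Data.ofNat (nStk t.top),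
            Data.ofNat (nQ t.tgt), Data.ofList (t.push.map fun A => Data.ofNat (nStk A))])]

/-- On every encoding of the instance `x`, the program `p` halts after at most `B` steps, and its
answer is correct: in the end variable `0` is not `nil` if and only if there is a
super-synchroniser between `(I, ⊥)` and `s`. -/
def DecidedWithin (x : DetInstance) (p : Prog) (B : ℝ) : Prop :=
  ∀ d : Data, x.Encodes d → ∃ (σ : Store) (t : ℕ), Run p (inputStore d) σ t ∧ (t : ℝ) ≤ B ∧
    (σ 0 ≠ Data.nil ↔ x.P.SuperSync (x.I : Set x.Q) [x.P.bot] x.s)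

end DetInstance

/-! ## Typed encodings and running times -/

/-! The observer's knowledge is represented by a list of states, repetitions allowed. By
determinism, for a given letter and top symbol, each member of a list `L` enables at most one
transition, and each transition lies in exactly one class. So the successor lists of `L` have total
length at most `|L|` (`length_moves_toRaw_le`, `exists_nodup_succs`). All lists that matter
therefore have length at most `k = |I|`. The same count passes through whole strategies: the family
`F` of lists in which the symbol on top of `L` is finally popped can be taken of total length at
most `|L|`. Its members are nonempty, so there are at most `k` of them. This leaves `n ^ O(k)` lists
and `n ^ O(k ^ 2)` families.

That popping `A` from `L` into `F` can be forced does not depend on the stack below `A`. The true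
entries `(L, A, F)` are thus generated by a monotone rule on a finite table, where a pushed word is
popped by chaining entries letter by letter (`popList`). A second monotone rule generates the lists
that win over the bare bottom symbol. Soundness is an induction over the generation of the tables
(`valid_of_mem_popTable`, `force_of_mem_winTable`). Completeness is an induction over the strategy
(`mem_popList_of_force`), in which `exists_small_of_mem_popList` keeps the families small.

A table is stable after as many rounds as it has candidates, so the time is polynomial in the number
of candidates, that is `n ^ O(k ^ 2)`; for `k ≥ 1` this is below `n ^ (4 c k ^ 3)`. For `k = 0` the
answer is always no. The running time itself is derived from closure properties of polynomial-time
functions, each realised by a program on registers (`RunsIn`, `PolyTimeIn`); only the enumeration of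
lists and families exceeds polynomial time, and it is charged to a separate measure. -/

/-- The number of nodes of a tree, with the empty leaves. -/
def Data.size : Data → ℕ
  | nil => 1
  | cons x y => x.size + y.size + 1

/-- Types whose elements are presented as trees. -/
class Enc (α : Type) where
  enc : α → Data

open Enc

instance : Enc Unit := ⟨fun _ => Data.nil⟩

instance : Enc Bool := ⟨fun b => bif b then Data.cons Data.nil Data.nil else Data.nil⟩

instance : Enc ℕ := ⟨Data.ofNat⟩

instance {α β : Type} [Enc α] [Enc β] : Enc (α × β) := ⟨fun p => Data.cons (enc p.1) (enc p.2)⟩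

instance {α : Type} [Enc α] : Enc (List α) := ⟨fun l => Data.ofList (l.map enc)⟩

section

variable {α β γ : Type} [Enc α] [Enc β] [Enc γ]

/-- The size of an encoding, plus one. -/
def sz (a : α) : ℕ := (enc a).size + 1

theorem Data.size_pos (d : Data) : 1 ≤ d.size := by
  cases d <;> simp [Data.size]

/-- The base of every polynomial bound is thus at least 2, so raising the exponent absorbs constants
and sums. -/
theorem two_le_sz (a : α) : 2 ≤ sz a := by
  have := (enc a).size_pos
  unfold sz
  omega

@[simp] theorem enc_true : enc true = Data.cons Data.nil Data.nil := rfl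

@[simp] theorem enc_false : enc false = Data.nil := rfl

@[simp] theorem enc_pair (a : α) (b : β) : enc (a, b) = Data.cons (enc a) (enc b) := rfl

@[simp] theorem enc_list_nil : enc ([] : List α) = Data.nil := rfl

@[simp] theorem enc_list_cons (a : α) (l : List α) : enc (a :: l) = Data.cons (enc a) (enc l) := rfl

@[simp] theorem enc_zero : enc (0 : ℕ) = Data.nil := rfl

@[simp] theorem enc_succ (n : ℕ) : enc (n + 1) = Data.cons Data.nil (enc n) := rfl

theorem enc_bool_ne_nil (b : Bool) : enc b ≠ Data.nil ↔ b = true := by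
  cases b <;> simp

/-- The extra one in `sz` is there to make it exactly additive on pairs and on `cons`. -/
theorem sz_pair (a : α) (b : β) : sz (a, b) = sz a + sz b := by
  simp only [sz, enc_pair, Data.size]; omega

@[simp] theorem sz_list_nil : sz ([] : List α) = 2 := rfl

theorem sz_list_cons (a : α) (l : List α) : sz (a :: l) = sz a + sz l := by
  simp only [sz, enc_list_cons, Data.size]; omega

theorem sz_bool_le (b : Bool) : sz b ≤ 4 := by
  cases b <;> simp [sz, Data.size]

theorem sz_nat (n : ℕ) : sz n = 2 * n + 2 := by
  induction n with
  | zero => rfl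
  | succ n ih => simp only [sz, enc_succ, Data.size] at *; omega

theorem sz_list (l : List α) : sz l = 2 + (l.map sz).sum := by
  induction l with
  | nil => rfl
  | cons a l ih => rw [sz_list_cons, ih, List.map_cons, List.sum_cons]; omega

theorem length_lt_sz (l : List α) : l.length < sz l := by
  induction l with
  | nil => simp
  | cons a l ih => rw [sz_list_cons, List.length_cons]; have := two_le_sz a; omega

theorem sz_le_of_mem {a : α} {l : List α} (h : a ∈ l) : sz a ≤ sz l := by
  rw [sz_list]
  have := List.single_le_sum (l := l.map sz) (by simp) (sz a) (List.mem_map_of_mem h)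
  omega

theorem sz_append (l m : List α) : sz (l ++ m) + 2 = sz l + sz m := by
  simp only [sz_list, List.map_append, List.sum_append]; omega

theorem sz_le_of_sublist {l m : List α} (h : l.Sublist m) : sz l ≤ sz m := by
  rw [sz_list, sz_list]
  have := (h.map sz).sum_le_sum (by simp)
  omega

theorem sz_reverse (l : List α) : sz l.reverse = sz l := by
  simp only [sz_list, List.map_reverse, List.sum_reverse]

theorem sz_le_of_forall {l : List α} {K B : ℕ} (hl : l.length ≤ K) (hB : ∀ a ∈ l, sz a ≤ B) :
    sz l ≤ 2 + K * B := by
  rw [sz_list]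
  have h := List.sum_le_card_nsmul (l.map sz) B (by simpa using hB)
  simp only [List.length_map, smul_eq_mul] at h
  have := Nat.mul_le_mul_right B hl
  omega

theorem sz_map_fst_le (l : List (β × γ)) : sz (l.map fun y => y.1) ≤ sz l := by
  rw [sz_list, sz_list, List.map_map]
  refine Nat.add_le_add_left (List.sum_le_sum fun y _ => ?_) _
  have := sz_pair y.1 y.2
  simp only [Prod.mk.eta] at this
  simp only [Function.comp_apply]
  omega

/-! ### Polynomial bounds -/

/-- `g` is bounded by a polynomial in the size of the argument and the measure `N`. -/
def PolyBdd (N g : α → ℕ) : Prop := ∃ c : ℕ, ∀ a, g a ≤ (N a + sz a) ^ c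

namespace PolyBdd

variable {N g h : α → ℕ}

theorem mono (hh : PolyBdd N h) (hle : ∀ a, g a ≤ h a) : PolyBdd N g := by
  obtain ⟨c, hc⟩ := hh
  exact ⟨c, fun a => (hle a).trans (hc a)⟩

theorem const (K : ℕ) : PolyBdd N fun _ => K :=
  ⟨K, fun a => (Nat.lt_two_pow_self (n := K)).le.trans
    (Nat.pow_le_pow_left ((two_le_sz a).trans (Nat.le_add_left _ _)) _)⟩

theorem size : PolyBdd N sz := ⟨1, fun a => by simp⟩

theorem measure : PolyBdd N N := ⟨1, fun a => by simp⟩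

theorem mul (hg : PolyBdd N g) (hh : PolyBdd N h) : PolyBdd N fun a => g a * h a := by
  obtain ⟨c, hc⟩ := hg
  obtain ⟨d, hd⟩ := hh
  exact ⟨c + d, fun a => by rw [pow_add]; exact Nat.mul_le_mul (hc a) (hd a)⟩

theorem add (hg : PolyBdd N g) (hh : PolyBdd N h) : PolyBdd N fun a => g a + h a := by
  obtain ⟨c, hc⟩ := hg
  obtain ⟨d, hd⟩ := hh
  refine ⟨c + d + 1, fun a => ?_⟩
  have h2 : 2 ≤ N a + sz a := (two_le_sz a).trans (Nat.le_add_left _ _)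
  have h1 := (hc a).trans (Nat.pow_le_pow_right (by omega) (Nat.le_add_right c d))
  have h3 := (hd a).trans (Nat.pow_le_pow_right (by omega) (Nat.le_add_left d c))
  calc g a + h a ≤ (N a + sz a) ^ (c + d) * 2 := by omega
    _ ≤ (N a + sz a) ^ (c + d) * (N a + sz a) := Nat.mul_le_mul_left _ h2
    _ = _ := (pow_succ _ _).symm

theorem pow (hg : PolyBdd N g) (d : ℕ) : PolyBdd N fun a => g a ^ d := by
  obtain ⟨c, hc⟩ := hg
  exact ⟨c * d, fun a => by rw [pow_mul]; exact Nat.pow_le_pow_left (hc a) d⟩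

theorem comp {f : α → β} {g : β → ℕ} (hg : PolyBdd 0 g) (hf : PolyBdd N fun a => sz (f a)) :
    PolyBdd N fun a => g (f a) := by
  obtain ⟨d, hd⟩ := hg
  exact (hf.pow d).mono fun a => by simpa using hd (f a)

end PolyBdd

/-! ### Executions -/

/-- Started in `σ`, the program `p` halts within `T` steps in a store that satisfies `R`. -/
def Exec (p : Prog) (σ : Store) (R : Store → Prop) (T : ℕ) : Prop :=
  ∃ (σ' : Store) (t : ℕ), Run p σ σ' t ∧ R σ' ∧ t ≤ T

namespace Exec

variable {p q : Prog} {σ : Store} {R R' : Store → Prop} {T U : ℕ}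

theorem mono (h : Exec p σ R T) (hR : ∀ σ', R σ' → R' σ') (hT : T ≤ U) : Exec p σ R' U := by
  obtain ⟨σ', t, h₁, h₂, h₃⟩ := h
  exact ⟨σ', t, h₁, hR _ h₂, h₃.trans hT⟩

theorem assign (i : ℕ) (e : Expr) (h : R (Function.update σ i (e.eval σ))) :
    Exec (.assign i e) σ R (e.cost + 1) :=
  ⟨_, _, .assign i e σ, h, le_rfl⟩

theorem seq (h : Exec p σ R T) (h' : ∀ σ', R σ' → Exec q σ' R' U) :
    Exec (.seq p q) σ R' (T + U) := by
  obtain ⟨σ', t, h₁, h₂, h₃⟩ := h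
  obtain ⟨σ'', u, k₁, k₂, k₃⟩ := h' σ' h₂
  exact ⟨σ'', t + u, .seq h₁ k₁, k₂, by omega⟩

theorem ite {e : Expr} (h₁ : e.eval σ ≠ Data.nil → Exec p σ R T)
    (h₂ : e.eval σ = Data.nil → Exec q σ R U) : Exec (.ite e p q) σ R (e.cost + 1 + (T + U)) := by
  by_cases he : e.eval σ = Data.nil
  · obtain ⟨σ', t, k₁, k₂, k₃⟩ := h₂ he
    exact ⟨σ', _, .ite_false he k₁, k₂, by omega⟩
  · obtain ⟨σ', t, k₁, k₂, k₃⟩ := h₁ he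
    exact ⟨σ', _, .ite_true he k₁, k₂, by omega⟩

theorem while_step {e : Expr} (he : e.eval σ ≠ Data.nil) (h : Exec p σ R T)
    (h' : ∀ σ', R σ' → Exec (.while e p) σ' R' U) :
    Exec (.while e p) σ R' (e.cost + 1 + T + U) := by
  obtain ⟨σ', t, h₁, h₂, h₃⟩ := h
  obtain ⟨σ'', u, k₁, k₂, k₃⟩ := h' σ' h₂
  exact ⟨σ'', _, .while_true he h₁ k₁, k₂, by omega⟩

theorem while_end {e : Expr} (he : e.eval σ = Data.nil) (h : R σ) :
    Exec (.while e p) σ R (e.cost + 1) :=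
  ⟨σ, _, .while_false he, h, le_rfl⟩

end Exec

/-- For every register `b` there is a program that replaces the encoding of `a` in register `b` by
that of `f a` within `T a` steps, and leaves the registers below `b` unchanged. -/
def RunsIn (f : α → β) (T : α → ℕ) : Prop :=
  ∀ b : ℕ, ∃ p : Prog, ∀ (σ : Store) (a : α), σ b = enc a →
    Exec p σ (fun σ' => σ' b = enc (f a) ∧ ∀ i < b, σ' i = σ i) (T a)

/-- Registers are used like a stack: a program for register `b` may overwrite everything above `b`
and must preserve everything below. Hence subprograms compose without renaming variables. -/
theorem RunsIn.comp {f : α → β} {g : β → γ} {T : α → ℕ} {U : β → ℕ} (hf : RunsIn f T)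
    (hg : RunsIn g U) : RunsIn (fun a => g (f a)) fun a => T a + U (f a) := fun b => by
  obtain ⟨p, hp⟩ := hf b
  obtain ⟨q, hq⟩ := hg b
  refine ⟨.seq p q, fun σ a ha => (hp σ a ha).seq fun σ' h => ?_⟩
  refine (hq σ' _ h.1).mono (fun σ'' h' => ⟨h'.1, fun i hi => ?_⟩) le_rfl
  rw [h'.2 i hi, h.2 i hi]

theorem RunsIn.of_expr {f : α → β} (e : ℕ → Expr) (K : ℕ) (hK : ∀ b, (e b).cost + 1 ≤ K)
    (he : ∀ b σ a, σ b = enc a → (e b).eval σ = enc (f a)) : RunsIn f fun _ => K := fun b =>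
  ⟨.assign b (e b), fun σ a ha => (Exec.assign b (e b)
    (R := fun σ' => σ' b = enc (f a) ∧ ∀ i < b, σ' i = σ i)
    ⟨by simp [he b σ a ha], fun i hi => by simp [hi.ne]⟩).mono (fun _ h => h) (hK b)⟩

theorem RunsIn.pair {f : α → β} {g : α → γ} {T U : α → ℕ} (hf : RunsIn f T) (hg : RunsIn g U) :
    RunsIn (fun a => (f a, g a)) fun a => T a + U a + 8 := fun b => by
  obtain ⟨p, hp⟩ := hf (b + 1)
  obtain ⟨q, hq⟩ := hg (b + 2)
  refine ⟨.seq (.assign (b + 1) (.var b)) (.seq p (.seq (.assign (b + 2) (.var b)) (.seq q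
    (.assign b (.cons (.var (b + 1)) (.var (b + 2))))))), fun σ a ha => ?_⟩
  refine Exec.mono (Exec.seq (Exec.assign _ _
    (R := fun σ' => σ' (b + 1) = enc a ∧ ∀ i ≤ b, σ' i = σ i) ?_) fun σ₁ h₁ =>
    Exec.seq (hp σ₁ a h₁.1) fun σ₂ h₂ => Exec.seq (Exec.assign _ _
    (R := fun σ' => σ' (b + 2) = enc a ∧ σ' (b + 1) = enc (f a) ∧ ∀ i ≤ b, σ' i = σ i) ?_)
    fun σ₃ h₃ => Exec.seq (hq σ₃ a h₃.1) fun σ₄ h₄ => Exec.assign _ _ ?_) (fun _ h => h)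
    (by simp only [Expr.cost]; omega)
  · refine ⟨by simp [Expr.eval, ha], fun i hi => ?_⟩
    rw [Function.update_of_ne (by omega)]
  · refine ⟨?_, ?_, fun i hi => ?_⟩
    · simp [Expr.eval, h₂.2 b (by omega), h₁.2 b le_rfl, ha]
    · rw [Function.update_of_ne (by omega), h₂.1]
    · rw [Function.update_of_ne (by omega), h₂.2 i (by omega), h₁.2 i hi]
  · refine ⟨?_, fun i hi => ?_⟩
    · simp [Expr.eval, h₄.1, h₄.2 (b + 1) (by omega), h₃.2.1]
    · rw [Function.update_of_ne (by omega), h₄.2 i (by omega), h₃.2.2 i hi.le]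

theorem RunsIn.cond {c : α → Bool} {f g : α → β} {S T U : α → ℕ} (hc : RunsIn c S)
    (hf : RunsIn f T) (hg : RunsIn g U) :
    RunsIn (fun a => bif c a then f a else g a) fun a => S a + (T a + U a) + 4 := fun b => by
  obtain ⟨p, hp⟩ := hc (b + 1)
  obtain ⟨q, hq⟩ := hf b
  obtain ⟨r, hr⟩ := hg b
  refine ⟨.seq (.assign (b + 1) (.var b)) (.seq p (.ite (.var (b + 1)) q r)), fun σ a ha => ?_⟩
  refine Exec.mono (Exec.seq (Exec.assign _ _
    (R := fun σ' => σ' (b + 1) = enc a ∧ ∀ i ≤ b, σ' i = σ i) ?_) fun σ₁ h₁ =>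
    Exec.seq (hp σ₁ a h₁.1) fun σ₂ h₂ => Exec.ite (fun he => (hq σ₂ a ?_).mono ?_ le_rfl)
      fun he => (hr σ₂ a ?_).mono ?_ le_rfl) (fun _ h => h)
    (by simp only [Expr.cost]; omega)
  · refine ⟨by simp [Expr.eval, ha], fun i hi => ?_⟩
    rw [Function.update_of_ne (by omega)]
  · rw [h₂.2 b (by omega), h₁.2 b le_rfl, ha]
  · simp only [Expr.eval, h₂.1] at he
    simp only [(enc_bool_ne_nil _).1 he, cond_true]
    exact fun σ₃ h₃ => ⟨h₃.1, fun i hi => by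
      rw [h₃.2 i hi, h₂.2 i (by omega), h₁.2 i (by omega)]⟩
  · rw [h₂.2 b (by omega), h₁.2 b le_rfl, ha]
  · simp only [Expr.eval, h₂.1] at he
    have : c a = false := by
      by_contra h
      exact (enc_bool_ne_nil (c a)).2 (by simpa using h) he
    simp only [this, cond_false]
    exact fun σ₃ h₃ => ⟨h₃.1, fun i hi => by
      rw [h₃.2 i hi, h₂.2 i (by omega), h₁.2 i (by omega)]⟩

theorem RunsIn.foldl {l : α → List β} {i : α → γ} {f : α → γ → β → γ} {T U : α → ℕ}
    {S : α × γ × β → ℕ} {B : α → ℕ} (hl : RunsIn l T) (hi : RunsIn i U)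
    (hf : RunsIn (fun x : α × γ × β => f x.1 x.2.1 x.2.2) S)
    (hB : ∀ a m x, m ++ [x] <+: l a → S (a, m.foldl (f a) (i a), x) ≤ B a) :
    RunsIn (fun a => (l a).foldl (f a) (i a))
      fun a => T a + U a + (l a).length * (B a + 14) + 8 := fun b => by
  obtain ⟨p, hp⟩ := hl (b + 1)
  obtain ⟨q, hq⟩ := hi (b + 2)
  obtain ⟨r, hr⟩ := hf (b + 3)
  -- Register `b` keeps the argument, `b + 1` the unread part of the list, `b + 2` the accumulator;
  -- `b + 3` is the workspace of the step function.
  let body : Prog := .seq (.assign (b + 3) (.cons (.var b) (.cons (.var (b + 2))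
    (.hd (.var (b + 1)))))) (.seq r (.seq (.assign (b + 2) (.var (b + 3)))
      (.assign (b + 1) (.tl (.var (b + 1))))))
  -- Invariant: `k` has been read, `m` is still to be read.
  have loop : ∀ (a : α) (m k : List β) (σ : Store), k ++ m = l a → σ b = enc a →
      σ (b + 1) = enc m → σ (b + 2) = enc (k.foldl (f a) (i a)) →
      Exec (.while (.var (b + 1)) body) σ
        (fun σ' => σ' (b + 2) = enc ((l a).foldl (f a) (i a)) ∧ ∀ j ≤ b, σ' j = σ j)
        (m.length * (B a + 14) + 2) := by
    intro a m
    induction m with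
    | nil =>
      intro k σ hk h₀ h₁ h₂
      refine (Exec.while_end (by simpa [Expr.eval] using h₁) ?_).mono (fun _ h => h)
        (by simp [Expr.cost])
      rw [← hk, List.append_nil]
      exact ⟨h₂, fun _ _ => rfl⟩
    | cons x m ih =>
      intro k σ hk h₀ h₁ h₂
      refine (Exec.while_step (by simp [Expr.eval, h₁]) (T := B a + 12)
        (R := fun σ' => σ' (b + 1) = enc m ∧ σ' (b + 2) = enc ((k ++ [x]).foldl (f a) (i a)) ∧
          ∀ j ≤ b, σ' j = σ j) ?_ (fun σ' h =>
            (ih (k ++ [x]) σ' (by simpa using hk) (by rw [h.2.2 b le_rfl, h₀]) h.1 h.2.1).mono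
              (fun σ'' h' => ⟨h'.1, fun j hj => by rw [h'.2 j hj, h.2.2 j hj]⟩) le_rfl)).mono
        (fun _ h => h) (by simp only [Expr.cost, List.length_cons, Nat.add_mul]; omega)
      have hS := hB a k x ⟨m, by simpa using hk⟩
      refine Exec.mono (Exec.seq (Exec.assign _ _ (R := fun σ' =>
        σ' (b + 3) = enc (a, k.foldl (f a) (i a), x) ∧ ∀ j ≤ b + 2, σ' j = σ j) ?_) fun σ₁ k₁ =>
        Exec.seq (hr σ₁ _ k₁.1) fun σ₂ k₂ => Exec.seq (Exec.assign _ _ (R := fun σ' =>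
        σ' (b + 2) = enc ((k ++ [x]).foldl (f a) (i a)) ∧ ∀ j ≤ b + 1, σ' j = σ j) ?_)
        fun σ₃ k₃ => Exec.assign _ _ ?_) (fun _ h => h)
        (U := B a + 12) (by simp only [Expr.cost]; omega)
      · refine ⟨by simp [Expr.eval, h₀, h₁, h₂, Data.hd], fun j hj => ?_⟩
        rw [Function.update_of_ne (by omega)]
      · refine ⟨by simp [Expr.eval, k₂.1], fun j hj => ?_⟩
        rw [Function.update_of_ne (by omega), k₂.2 j (by omega), k₁.2 j (by omega)]
      · refine ⟨by simp [Expr.eval, k₃.2 (b + 1) le_rfl, h₁, Data.tl], ?_, fun j hj => ?_⟩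
        · rw [Function.update_of_ne (by omega), k₃.1]
        · rw [Function.update_of_ne (by omega), k₃.2 j (by omega)]
  refine ⟨.seq (.assign (b + 1) (.var b)) (.seq p (.seq (.assign (b + 2) (.var b)) (.seq q
    (.seq (.while (.var (b + 1)) body) (.assign b (.var (b + 2))))))), fun σ a ha => ?_⟩
  refine Exec.mono (Exec.seq (Exec.assign _ _
    (R := fun σ' => σ' (b + 1) = enc a ∧ ∀ i ≤ b, σ' i = σ i) ?_) fun σ₁ h₁ =>
    Exec.seq (hp σ₁ a h₁.1) fun σ₂ h₂ => Exec.seq (Exec.assign _ _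
    (R := fun σ' => σ' (b + 2) = enc a ∧ σ' (b + 1) = enc (l a) ∧ ∀ i ≤ b, σ' i = σ i) ?_)
    fun σ₃ h₃ => Exec.seq (hq σ₃ a h₃.1) fun σ₄ h₄ => Exec.seq
      (loop a (l a) [] σ₄ rfl ?_ ?_ h₄.1) fun σ₅ h₅ => Exec.assign _ _ ?_) (fun _ h => h)
    (by simp only [Expr.cost]; omega)
  · refine ⟨by simp [Expr.eval, ha], fun i hi => ?_⟩
    rw [Function.update_of_ne (by omega)]
  · refine ⟨?_, ?_, fun i hi => ?_⟩
    · simp [Expr.eval, h₂.2 b (by omega), h₁.2 b le_rfl, ha]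
    · rw [Function.update_of_ne (by omega), h₂.1]
    · rw [Function.update_of_ne (by omega), h₂.2 i (by omega), h₁.2 i hi]
  · rw [h₄.2 b (by omega), h₃.2.2 b le_rfl, ha]
  · rw [h₄.2 (b + 1) (by omega), h₃.2.1]
  · refine ⟨by simp [Expr.eval, h₅.1], fun j hj => ?_⟩
    rw [Function.update_of_ne (by omega), h₅.2 j hj.le, h₄.2 j (by omega), h₃.2.2 j hj.le]

end

/-! ## Functions computable in polynomial time -/

section

variable {α β γ δ : Type} [Enc α] [Enc β] [Enc γ] [Enc δ]

/-- The function `f` is computable in time polynomial in the size of the argument and the measure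
`N`, with values of polynomial size. -/
def PolyTimeIn (N : α → ℕ) (f : α → β) : Prop :=
  PolyBdd N (fun a => sz (f a)) ∧ ∃ T, RunsIn f T ∧ PolyBdd N T

/-- Computability in polynomial time. -/
abbrev PolyTime (f : α → β) : Prop := PolyTimeIn 0 f

namespace PolyTimeIn

variable {N : α → ℕ}

theorem comp {f : α → β} {g : β → γ} (hg : PolyTime g) (hf : PolyTimeIn N f) :
    PolyTimeIn N fun a => g (f a) := by
  obtain ⟨hf, T, hT, hT'⟩ := hf
  obtain ⟨hg, U, hU, hU'⟩ := hg
  exact ⟨hg.comp hf, _, hT.comp hU, hT'.add (hU'.comp hf)⟩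

theorem of_expr {f : α → β} (e : ℕ → Expr) (K : ℕ) (hK : ∀ b, (e b).cost + 1 ≤ K)
    (he : ∀ b σ a, σ b = enc a → (e b).eval σ = enc (f a)) (hf : PolyBdd N fun a => sz (f a)) :
    PolyTimeIn N f :=
  ⟨hf, _, .of_expr e K hK he, .const K⟩

theorem pair {f : α → β} {g : α → γ} (hf : PolyTimeIn N f) (hg : PolyTimeIn N g) :
    PolyTimeIn N fun a => (f a, g a) := by
  obtain ⟨hf, T, hT, hT'⟩ := hf
  obtain ⟨hg, U, hU, hU'⟩ := hg
  exact ⟨(hf.add hg).mono fun a => (sz_pair _ _).le, _, hT.pair hU,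
    (hT'.add hU').add (.const 8)⟩

theorem cond {c : α → Bool} {f g : α → β} (hc : PolyTimeIn N c) (hf : PolyTimeIn N f)
    (hg : PolyTimeIn N g) : PolyTimeIn N fun a => bif c a then f a else g a := by
  obtain ⟨-, S, hS, hS'⟩ := hc
  obtain ⟨hf, T, hT, hT'⟩ := hf
  obtain ⟨hg, U, hU, hU'⟩ := hg
  refine ⟨(hf.add hg).mono fun a => ?_, _, hS.cond hT hU, (hS'.add (hT'.add hU')).add (.const 4)⟩
  dsimp only
  cases c a
  · exact Nat.le_add_left _ _
  · exact Nat.le_add_right _ _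

/-- A polynomial step alone is not enough, since iterating it could blow up the accumulator. The
bound `B` on all intermediate accumulators excludes this. -/
theorem foldl {l : α → List β} {i : α → γ} {f : α → γ → β → γ} {B : α → ℕ} (hl : PolyTimeIn N l)
    (hi : PolyTimeIn N i) (hf : PolyTime fun x : α × γ × β => f x.1 x.2.1 x.2.2)
    (hB : PolyBdd N B) (h : ∀ a m, m <+: l a → sz (m.foldl (f a) (i a)) ≤ B a) :
    PolyTimeIn N fun a => (l a).foldl (f a) (i a) := by
  obtain ⟨hl, T, hT, hT'⟩ := hl
  obtain ⟨-, U, hU, hU'⟩ := hi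
  obtain ⟨-, S, hS, c, hc⟩ := hf
  refine ⟨hB.mono fun a => h a _ List.prefix_rfl, _,
    hT.foldl hU hS (B := fun a => (sz a + (B a + sz (l a))) ^ c) ?_,
    ((hT'.add hU').add ((hl.mono fun a => (length_lt_sz (l a)).le).mul
      (((PolyBdd.size.add (hB.add hl)).pow c).add (.const 14)))).add (.const 8)⟩
  intro a m x hm
  refine (hc _).trans (Nat.pow_le_pow_left ?_ c)
  have h₁ := h a m ((List.prefix_append m [x]).trans hm)
  have h₂ : sz x ≤ sz (l a) := sz_le_of_mem (hm.subset (by simp))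
  simp only [Pi.zero_apply, sz_pair]
  omega

end PolyTimeIn

namespace PolyTime

theorem id : PolyTime fun a : α => a :=
  .of_expr .var 2 (fun _ => le_rfl) (fun _ _ _ h => h) .size

theorem of_enc_eq {f : α → β} (h : ∀ a, enc (f a) = enc a) : PolyTime f :=
  .of_expr .var 2 (fun _ => le_rfl) (fun _ _ a h' => h'.trans (h a).symm)
    (PolyBdd.size.mono fun a => by simp only [sz, h]; exact le_rfl)

theorem fst : PolyTime (Prod.fst : α × β → α) :=
  .of_expr (fun b => .hd (.var b)) 3 (fun _ => le_rfl)
    (fun _ _ a h => by simp only [Expr.eval, h]; rfl)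
    (PolyBdd.size.mono fun a => by have := sz_pair a.1 a.2; simp only [Prod.mk.eta] at this; omega)

theorem snd : PolyTime (Prod.snd : α × β → β) :=
  .of_expr (fun b => .tl (.var b)) 3 (fun _ => le_rfl)
    (fun _ _ a h => by simp only [Expr.eval, h]; rfl)
    (PolyBdd.size.mono fun a => by have := sz_pair a.1 a.2; simp only [Prod.mk.eta] at this; omega)

/-- The expression that builds a given tree. -/
def _root_.Data.toExpr : Data → Expr
  | .nil => .nil
  | .cons x y => .cons x.toExpr y.toExpr

theorem _root_.Data.eval_toExpr (σ : Store) (d : Data) : d.toExpr.eval σ = d := by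
  induction d with
  | nil => rfl
  | cons x y hx hy => simp [Data.toExpr, Expr.eval, hx, hy]

theorem const (b : β) : PolyTime fun _ : α => b :=
  .of_expr (fun _ => (enc b).toExpr) _ (fun _ => le_rfl) (fun _ _ _ _ => Data.eval_toExpr _ _)
    (.const _)

theorem list_cons : PolyTime fun x : β × List β => x.1 :: x.2 := of_enc_eq fun _ => rfl

theorem list_tail : PolyTime (List.tail : List β → List β) :=
  .of_expr (fun b => .tl (.var b)) 3 (fun _ => le_rfl)
    (fun _ _ l h => by simp only [Expr.eval, h]; cases l <;> rfl)
    (PolyBdd.size.mono fun l => sz_le_of_sublist (List.tail_sublist l))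

theorem nat_pred : PolyTime fun n : ℕ => n - 1 :=
  .of_expr (fun b => .tl (.var b)) 3 (fun _ => le_rfl)
    (fun _ _ n h => by simp only [Expr.eval, h]; cases n <;> rfl)
    (PolyBdd.size.mono fun n => by simp only [sz_nat]; omega)

theorem nat_replicate : PolyTime fun n : ℕ => List.replicate n () :=
  of_enc_eq fun n => by
    induction n with
    | zero => rfl
    | succ n ih => rw [List.replicate_succ, enc_list_cons, ih]; rfl

/-! ### Boolean connectives -/

section Bool

variable {f g : α → Bool}

theorem and (hf : PolyTime f) (hg : PolyTime g) : PolyTime fun a => f a && g a :=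
  (funext fun a => by cases f a <;> rfl : (fun a => f a && g a) = fun a => bif f a then g a else false)
    ▸ hf.cond hg (const false)

theorem or (hf : PolyTime f) (hg : PolyTime g) : PolyTime fun a => f a || g a :=
  (funext fun a => by cases f a <;> rfl : (fun a => f a || g a) = fun a => bif f a then true else g a)
    ▸ hf.cond (const true) hg

theorem not (hf : PolyTime f) : PolyTime fun a => !f a :=
  (funext fun a => by cases f a <;> rfl : (fun a => !f a) = fun a => bif f a then false else true)
    ▸ hf.cond (const false) (const true)

end Bool

/-! ### Operations on lists -/

section List

variable {l : α → List β}

theorem all {p : α → β → Bool} (hl : PolyTime l) (hp : PolyTime fun x : α × β => p x.1 x.2) :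
    PolyTime fun a => (l a).all (p a) := by
  have h : ∀ a, ∀ (m : List β) (b : Bool),
      m.foldl (fun b x => b && p a x) b = (b && m.all (p a)) := by
    intro a m
    induction m with
    | nil => simp
    | cons x m ih => intro b; simp [ih, Bool.and_assoc]
  have h' := PolyTimeIn.foldl (f := fun a b x => b && p a x) hl (const true)
    (and (fst.comp snd) (hp.comp (fst.pair (snd.comp snd)))) (.const 4) fun _ _ _ => sz_bool_le _
  simpa only [h, Bool.true_and] using h'

theorem any {p : α → β → Bool} (hl : PolyTime l) (hp : PolyTime fun x : α × β => p x.1 x.2) :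
    PolyTime fun a => (l a).any (p a) := by
  have := not (all (p := fun a x => !p a x) hl (not hp))
  simpa only [← List.not_any_eq_all_not, Bool.not_not] using this

theorem isEmpty (hl : PolyTime l) : PolyTime fun a => (l a).isEmpty :=
  (funext fun a => by cases l a <;> rfl :
    (fun a => (l a).isEmpty) = fun a => (l a).all fun _ => false) ▸ all hl (const false)

theorem reverseAux {m : α → List β} (hl : PolyTime l) (hm : PolyTime m) :
    PolyTime fun a => (l a).reverse ++ m a := by
  have h : ∀ (k : List β) (m : List β), k.foldl (fun m x => x :: m) m = k.reverse ++ m := by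
    intro k
    induction k with
    | nil => simp
    | cons x k ih => intro m; simp [ih]
  have h' := PolyTimeIn.foldl (f := fun _ m x => x :: m) hl hm
    (list_cons.comp ((snd.comp snd).pair (fst.comp snd))) (hl.1.add hm.1) fun a k hk => by
      have h₁ := sz_append k.reverse (m a)
      have h₂ := sz_le_of_sublist hk.sublist
      rw [sz_reverse] at h₁
      rw [h]
      omega
  simpa only [h] using h'

theorem reverse (hl : PolyTime l) : PolyTime fun a => (l a).reverse := by
  simpa using reverseAux hl (const [])

theorem append {m : α → List β} (hl : PolyTime l) (hm : PolyTime m) :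
    PolyTime fun a => l a ++ m a := by
  simpa using reverseAux (reverse hl) hm

theorem foldr {i : α → γ} {f : α → β → γ → γ} {B : α → ℕ} (hl : PolyTime l) (hi : PolyTime i)
    (hf : PolyTime fun x : α × β × γ => f x.1 x.2.1 x.2.2) (hB : PolyBdd 0 B)
    (h : ∀ a m, m <:+ l a → sz (m.foldr (f a) (i a)) ≤ B a) :
    PolyTime fun a => (l a).foldr (f a) (i a) := by
  have h' := PolyTimeIn.foldl (f := fun a c x => f a x c) (reverse hl) hi
    (hf.comp (fst.pair ((snd.comp snd).pair (fst.comp snd)))) hB fun a m hm => by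
      have := h a m.reverse (by simpa using List.reverse_suffix.2 hm)
      simpa [List.foldr_reverse] using this
  simpa only [List.foldl_reverse] using h'

omit [Enc β] in
theorem _root_.sz_flatMap_le {l : List β} {f : β → List γ} {B : ℕ} (h : ∀ x ∈ l, sz (f x) ≤ B) :
    sz (l.flatMap f) ≤ 2 + l.length * B := by
  induction l with
  | nil => simp
  | cons x l ih =>
    have h₁ := ih fun y hy => h y (List.mem_cons_of_mem _ hy)
    have h₂ := h x List.mem_cons_self
    have h₃ := sz_append (f x) (l.flatMap f)
    rw [List.flatMap_cons, List.length_cons, Nat.add_mul]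
    omega

theorem flatMap {f : α → β → List γ} (hl : PolyTime l) (hf : PolyTime fun x : α × β => f x.1 x.2) :
    PolyTime fun a => (l a).flatMap (f a) := by
  -- A fold can only push onto the front, so the result is built in reverse and turned round at the
  -- end.
  have h : ∀ a, ∀ (k : List β) (m : List γ),
      k.foldl (fun m x => (f a x).reverse ++ m) m = (k.flatMap (f a)).reverse ++ m := by
    intro a k
    induction k with
    | nil => simp
    | cons x k ih => intro m; simp [ih]
  obtain ⟨c, hc⟩ := hf.1
  have h' := PolyTimeIn.foldl (f := fun a m x => (f a x).reverse ++ m)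
    (B := fun a => 2 + sz (l a) * (sz a + sz (l a)) ^ c) hl (const [])
    (reverseAux (hf.comp (fst.pair (snd.comp snd))) (fst.comp snd))
    ((PolyBdd.const 2).add (hl.1.mul ((PolyBdd.size.add hl.1).pow c))) fun a k hk => by
      rw [h, List.append_nil, sz_reverse]
      refine (sz_flatMap_le (B := (sz a + sz (l a)) ^ c) fun x hx => (hc (a, x)).trans ?_).trans ?_
      · refine Nat.pow_le_pow_left ?_ c
        have := sz_le_of_mem (hk.subset hx)
        simp only [Pi.zero_apply, sz_pair]
        omega
      · have := (hk.length_le.trans_lt (length_lt_sz (l a))).le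
        gcongr
  simpa only [h, List.append_nil, List.reverse_reverse] using reverse h'

theorem map {f : α → β → γ} (hl : PolyTime l) (hf : PolyTime fun x : α × β => f x.1 x.2) :
    PolyTime fun a => (l a).map (f a) := by
  have := flatMap (f := fun a x => [f a x]) hl (list_cons.comp (hf.pair (const [])))
  simpa only [← List.map_eq_flatMap] using this

theorem filter {p : α → β → Bool} (hl : PolyTime l) (hp : PolyTime fun x : α × β => p x.1 x.2) :
    PolyTime fun a => (l a).filter (p a) := by
  have h : ∀ a, (l a).flatMap (fun x => bif p a x then [x] else []) = (l a).filter (p a) := by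
    intro a
    induction l a with
    | nil => rfl
    | cons x k ih => cases hx : p a x <;> simp [hx, ih]
  have := flatMap (f := fun a x => bif p a x then [x] else []) hl
    (hp.cond (list_cons.comp (snd.pair (const []))) (const []))
  simpa only [h] using this

theorem dropLast (hl : PolyTime l) : PolyTime fun a => (l a).dropLast := by
  have := reverse (list_tail.comp (reverse hl))
  simpa only [List.tail_reverse, List.reverse_reverse] using this

end List

/-! ### Arithmetic and comparison of unary numbers and of lists of them -/

theorem nat_sub : PolyTime fun x : ℕ × ℕ => x.1 - x.2 := by
  have h : ∀ n m : ℕ, (List.replicate m ()).foldl (fun n _ => n - 1) n = n - m := by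
    intro n m
    induction m generalizing n with
    | zero => rfl
    | succ m ih => rw [List.replicate_succ, List.foldl_cons, ih]; omega
  have h' := PolyTimeIn.foldl (f := fun (_ : ℕ × ℕ) n (_ : Unit) => n - 1)
    (l := fun x => List.replicate x.2 ()) (nat_replicate.comp snd) fst
    (nat_pred.comp (fst.comp snd)) (fst (β := ℕ)).1 fun x m hm => by
      have : m = List.replicate m.length () := List.eq_replicate_of_mem fun _ _ => rfl
      rw [this, h, sz_nat, sz_nat]
      omega
  simpa only [h] using h'

theorem nat_beq : PolyTime fun x : ℕ × ℕ => x.1 == x.2 := by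
  -- Two numbers are equal when both truncated differences vanish.
  have h : ∀ x : ℕ × ℕ, ((List.replicate (x.1 - x.2) ()).isEmpty &&
      (List.replicate (x.2 - x.1) ()).isEmpty) = (x.1 == x.2) := by
    intro x
    rw [Bool.eq_iff_iff]
    simp
    omega
  simpa only [h] using and (isEmpty (nat_replicate.comp nat_sub))
    (isEmpty (nat_replicate.comp (nat_sub.comp (snd.pair fst))))

/-- The default costs nothing: `hd` of `nil` is `nil`, which encodes `0`. -/
theorem headD_zero : PolyTime fun l : List ℕ => l.headD 0 :=
  .of_expr (fun b => .hd (.var b)) 3 (fun _ => le_rfl)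
    (fun _ _ l h => by simp only [Expr.eval, h]; cases l <;> rfl)
    (PolyBdd.size.mono fun l => by
      cases l with
      | nil => exact le_rfl
      | cons x l => exact sz_le_of_mem List.mem_cons_self)

theorem natList_beq : PolyTime fun x : List ℕ × List ℕ => x.1 == x.2 := by
  -- The fold runs over one list and carries the unread part of the other, with a flag for agreement
  -- so far. The lists are equal if the flag survives and nothing is left unread.
  let f : Bool × List ℕ → ℕ → Bool × List ℕ :=
    fun s y => (s.1 && (!s.2.isEmpty && (s.2.headD 0 == y)), s.2.tail)
  have h₂ : ∀ (m l : List ℕ) (b : Bool), (m.foldl f (b, l)).2 = l.drop m.length := by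
    intro m
    induction m with
    | nil => intro l b; rfl
    | cons y m ih => intro l b; rw [List.foldl_cons, ih]; simp
  have h₁ : ∀ (m l : List ℕ) (b : Bool),
      ((m.foldl f (b, l)).1 && (m.foldl f (b, l)).2.isEmpty) = (b && l == m) := by
    intro m
    induction m with
    | nil => intro l b; cases l <;> rfl
    | cons y m ih =>
      intro l b
      rw [List.foldl_cons, ih]
      cases l with
      | nil => simp
      | cons z l =>
        simp only [List.isEmpty_cons, List.headD_cons, List.tail_cons, List.cons_beq_cons]
        cases b <;> simp
  have hf : PolyTime fun x : (List ℕ × List ℕ) × (Bool × List ℕ) × ℕ => f x.2.1 x.2.2 :=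
    (and (fst.comp (fst.comp snd)) (and (not (isEmpty (snd.comp (fst.comp snd))))
      (nat_beq.comp ((headD_zero.comp (snd.comp (fst.comp snd))).pair (snd.comp snd))))).pair
      (list_tail.comp (snd.comp (fst.comp snd)))
  have h' := PolyTimeIn.foldl (f := fun _ s y => f s y) (l := fun x : List ℕ × List ℕ => x.2)
    (i := fun x => (true, x.1)) (B := fun x => 4 + sz x.1) snd ((const true).pair fst) hf
    ((PolyBdd.const 4).add (fst (β := List ℕ)).1) fun x m hm => by
      rw [← Prod.mk.eta (p := m.foldl _ _), sz_pair, h₂]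
      exact Nat.add_le_add (sz_bool_le _) (sz_le_of_sublist (List.drop_sublist _ _))
  have h'' := and (fst.comp h') (isEmpty (snd.comp h'))
  simpa only [h₁, Bool.true_and] using h''

theorem contains {l : α → List (List ℕ)} {m : α → List ℕ} (hl : PolyTime l) (hm : PolyTime m) :
    PolyTime fun a => (l a).contains (m a) := by
  have := any (p := fun a x => m a == x) hl (natList_beq.comp ((hm.comp fst).pair snd))
  simpa only [List.contains_eq_any_beq] using this

theorem nat_contains {l : α → List ℕ} {m : α → ℕ} (hl : PolyTime l) (hm : PolyTime m) :
    PolyTime fun a => (l a).contains (m a) := by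
  have := any (p := fun a x => m a == x) hl (nat_beq.comp ((hm.comp fst).pair snd))
  simpa only [List.contains_eq_any_beq] using this

end PolyTime

end

/-! ## The algorithm -/

/-- A transition `(src, inp, top, tgt, push)` over numbers. -/
abbrev RawTransition : Type := ℕ × ℕ × ℕ × ℕ × List ℕ × Unit

namespace RawTransition

abbrev src (t : RawTransition) : ℕ := t.1
abbrev inp (t : RawTransition) : ℕ := t.2.1
abbrev top (t : RawTransition) : ℕ := t.2.2.1
abbrev tgt (t : RawTransition) : ℕ := t.2.2.2.1
abbrev push (t : RawTransition) : List ℕ := t.2.2.2.2.1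

end RawTransition

/-- The transitions that can occur from a state in `L` on input `a` with top symbol `A`. -/
def moves (δ : List RawTransition) (L : List ℕ) (a A : ℕ) : List RawTransition :=
  δ.filter fun t => L.contains t.src && (t.inp == a && t.top == A)

/-- The targets of the transitions that push `γ`. -/
def targets (R : List RawTransition) (γ : List ℕ) : List ℕ :=
  (R.filter fun u => u.push == γ).map fun u => u.tgt

/-- The successors of `(L, A :: η)` on input `a`, as pairs of a list of states and a pushed word. -/
def succs (δ : List RawTransition) (L : List ℕ) (a A : ℕ) : List (List ℕ × List ℕ) :=
  (moves δ L a A).map fun t => (targets (moves δ L a A) t.push, t.push)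

/-- An entry `(L, A, F)` of a table says that from `L` with `A` on top of the stack one can
force the system to pop `A` in such a way that the knowledge becomes a member of `F`. -/
abbrev Entry : Type := List ℕ × ℕ × List (List ℕ)

/-- The state lists from which the table `T` guarantees that one can pop the word `γ` and end up in
`G`. -/
def popList (T : List Entry) (γ : List ℕ) (G : List (List ℕ)) : List (List ℕ) :=
  γ.foldr (fun B G => (T.filter fun x => x.2.1 == B && x.2.2.all fun M => G.contains M).map
    fun x => x.1) G

/-- Does the table `T` justify the entry `x`? -/
def popCheck (δ : List RawTransition) (T : List Entry) (x : Entry) : Bool :=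
  (δ.map fun t => t.inp).any fun a => !(succs δ x.1 a x.2.1).isEmpty &&
    (succs δ x.1 a x.2.1).all fun c => (popList T c.2 x.2.2).contains c.1

/-- Given the table `T` of pops and the list `G` of state lists that are known to be winning over
the bottom symbol `bot`, is `L` winning as well? -/
def winCheck (δ : List RawTransition) (s bot : ℕ) (T : List Entry) (G : List (List ℕ))
    (L : List ℕ) : Bool :=
  (!L.isEmpty && L.all fun p => p == s) ||
    (δ.map fun t => t.inp).any fun a => !(succs δ L a bot).isEmpty &&
      (succs δ L a bot).all fun c => (popList T c.2.dropLast G).contains c.1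

/-- The members of `X` that the rules described by `check` generate. -/
def saturate {β : Type} (X : List β) (check : List β → β → Bool) : List β :=
  X.foldl (fun T _ => X.filter fun x => check T x) []

/-- The entries with state lists from `U` and target families from `V`. -/
def entries (δ : List RawTransition) (U : List (List ℕ)) (V : List (List (List ℕ))) : List Entry :=
  U.flatMap fun L => (δ.map fun t => t.top).flatMap fun A => V.map fun F => (L, A, F)

def popTable (δ : List RawTransition) (U : List (List ℕ)) (V : List (List (List ℕ))) :
    List Entry :=
  saturate (entries δ U V) fun T x => popCheck δ T x

def winTable (δ : List RawTransition) (s bot : ℕ) (U : List (List ℕ)) (T : List Entry) :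
    List (List ℕ) :=
  saturate U fun G L => winCheck δ s bot T G L

/-- The lists over `X` that are at most as long as `l`. -/
def listsUpTo {β ι : Type} (X : List β) (l : List ι) : List (List β) :=
  l.foldl (fun E _ => [] :: X.flatMap fun x => E.map fun m => x :: m) [[]]

/-- An instance over numbers: the initial states, the final state, the bottom symbol, the numbers of
states, letters and symbols, and the transitions. -/
abbrev RawInstance : Type := List ℕ × ℕ × ℕ × ℕ × ℕ × ℕ × List RawTransition × Unit

namespace RawInstance

abbrev init (r : RawInstance) : List ℕ := r.1
abbrev final (r : RawInstance) : ℕ := r.2.1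
abbrev bot (r : RawInstance) : ℕ := r.2.2.1
abbrev δ (r : RawInstance) : List RawTransition := r.2.2.2.2.2.2.1

/-- The initial states and the targets of transitions. -/
def states (r : RawInstance) : List ℕ := r.init ++ r.δ.map fun t => t.tgt

def stateLists (r : RawInstance) : List (List ℕ) := listsUpTo r.states r.init

def families (r : RawInstance) : List (List (List ℕ)) := listsUpTo r.stateLists r.init

/-- The answer computed from the instance, its state lists and its families. -/
def answerWith (x : RawInstance × List (List ℕ) × List (List (List ℕ))) : Bool :=
  (winTable x.1.δ x.1.final x.1.bot x.2.1 (popTable x.1.δ x.2.1 x.2.2)).contains x.1.init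

def answer (r : RawInstance) : Bool := answerWith (r, r.stateLists, r.families)

end RawInstance

/-! ### Running times -/

namespace PolyTime

variable {α β γ : Type} [Enc α] [Enc β] [Enc γ]

section RawTransition

variable {t : α → RawTransition}

theorem src (h : PolyTime t) : PolyTime fun x => (t x).src := fst.comp h

theorem inp (h : PolyTime t) : PolyTime fun x => (t x).inp := fst.comp (snd.comp h)

theorem top (h : PolyTime t) : PolyTime fun x => (t x).top := fst.comp (snd.comp (snd.comp h))

theorem tgt (h : PolyTime t) : PolyTime fun x => (t x).tgt :=
  fst.comp (snd.comp (snd.comp (snd.comp h)))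

theorem push (h : PolyTime t) : PolyTime fun x => (t x).push :=
  fst.comp (snd.comp (snd.comp (snd.comp (snd.comp h))))

end RawTransition

variable {δ : α → List RawTransition} {L γ : α → List ℕ} {a A s bot : α → ℕ}
  {T : α → List Entry} {G U : α → List (List ℕ)} {V : α → List (List (List ℕ))}

theorem moves (hδ : PolyTime δ) (hL : PolyTime L) (ha : PolyTime a) (hA : PolyTime A) :
    PolyTime fun x => moves (δ x) (L x) (a x) (A x) :=
  filter (p := fun x (t : RawTransition) => (L x).contains t.src && (t.inp == a x && t.top == A x)) hδ
    (and (nat_contains (hL.comp fst) (src snd))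
      (and (nat_beq.comp ((inp snd).pair (ha.comp fst)))
        (nat_beq.comp ((top snd).pair (hA.comp fst)))))

theorem targets {R : α → List RawTransition} (hR : PolyTime R) (hγ : PolyTime γ) :
    PolyTime fun x => targets (R x) (γ x) :=
  map (f := fun _ (u : RawTransition) => u.tgt)
    (filter (p := fun x (u : RawTransition) => u.push == γ x) hR (natList_beq.comp ((push snd).pair (hγ.comp fst))))
    (tgt snd)

theorem succs (hδ : PolyTime δ) (hL : PolyTime L) (ha : PolyTime a) (hA : PolyTime A) :
    PolyTime fun x => succs (δ x) (L x) (a x) (A x) :=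
  map (f := fun x (t : RawTransition) => (_root_.targets (_root_.moves (δ x) (L x) (a x) (A x)) t.push, t.push))
    (moves hδ hL ha hA)
    ((targets ((moves hδ hL ha hA).comp fst) (push snd)).pair (push snd))

theorem popList (hT : PolyTime T) (hγ : PolyTime γ) (hG : PolyTime G) :
    PolyTime fun x => popList (T x) (γ x) (G x) := by
  refine foldr (f := fun x B G => ((T x).filter fun y => y.2.1 == B &&
    y.2.2.all fun M => G.contains M).map fun y => y.1) (B := fun x => sz (G x) + sz (T x)) hγ hG
    (map (f := fun _ y => y.1) (filter (p := fun (z : α × ℕ × List (List ℕ)) y =>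
      y.2.1 == z.2.1 && y.2.2.all fun M => z.2.2.contains M) (hT.comp fst)
      (and (nat_beq.comp ((fst.comp (snd.comp snd)).pair (fst.comp (snd.comp fst))))
        (all (p := fun (w : (α × ℕ × List (List ℕ)) × Entry) M => w.1.2.2.contains M)
          (snd.comp (snd.comp snd)) (contains (snd.comp (snd.comp (fst.comp fst))) snd))))
      (fst.comp snd)) (hG.1.add hT.1) fun x m hm => ?_
  -- After at least one letter the accumulator is a projection of a sublist of `T`, so it cannot
  -- grow with the length of the word.
  cases m with
  | nil => exact Nat.le_add_right _ _
  | cons B m =>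
    rw [List.foldr_cons]
    exact (sz_map_fst_le _).trans
      ((sz_le_of_sublist List.filter_sublist).trans (Nat.le_add_left _ _))

theorem popCheck {x : α → Entry} (hδ : PolyTime δ) (hT : PolyTime T) (hx : PolyTime x) :
    PolyTime fun y => popCheck (δ y) (T y) (x y) := by
  have hs : PolyTime fun z : α × ℕ => _root_.succs (δ z.1) (x z.1).1 z.2 (x z.1).2.1 :=
    succs (hδ.comp fst) (fst.comp (hx.comp fst)) snd (fst.comp (snd.comp (hx.comp fst)))
  exact any (p := fun y a => !(_root_.succs (δ y) (x y).1 a (x y).2.1).isEmpty &&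
    (_root_.succs (δ y) (x y).1 a (x y).2.1).all fun c =>
      (_root_.popList (T y) c.2 (x y).2.2).contains c.1)
    (map (f := fun _ (t : RawTransition) => t.inp) hδ (inp snd))
    (and (not (isEmpty hs)) (all (p := fun (z : α × ℕ) c =>
      (_root_.popList (T z.1) c.2 (x z.1).2.2).contains c.1) hs
      (contains (popList (hT.comp (fst.comp fst)) (snd.comp snd)
        (snd.comp (snd.comp (hx.comp (fst.comp fst))))) (fst.comp snd))))

theorem winCheck (hδ : PolyTime δ) (hs : PolyTime s) (hbot : PolyTime bot) (hT : PolyTime T)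
    (hG : PolyTime G) (hL : PolyTime L) :
    PolyTime fun y => winCheck (δ y) (s y) (bot y) (T y) (G y) (L y) := by
  have hc : PolyTime fun z : α × ℕ => _root_.succs (δ z.1) (L z.1) z.2 (bot z.1) :=
    succs (hδ.comp fst) (hL.comp fst) snd (hbot.comp fst)
  exact or (and (not (isEmpty hL)) (all (p := fun y p => p == s y) hL
      (nat_beq.comp (snd.pair (hs.comp fst)))))
    (any (p := fun y a => !(_root_.succs (δ y) (L y) a (bot y)).isEmpty &&
    (_root_.succs (δ y) (L y) a (bot y)).all fun c =>
      (_root_.popList (T y) c.2.dropLast (G y)).contains c.1)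
    (map (f := fun _ (t : RawTransition) => t.inp) hδ (inp snd))
    (and (not (isEmpty hc)) (all (p := fun (z : α × ℕ) c =>
      (_root_.popList (T z.1) c.2.dropLast (G z.1)).contains c.1) hc
      (contains (popList (hT.comp (fst.comp fst)) (dropLast (snd.comp snd))
        (hG.comp (fst.comp fst))) (fst.comp snd)))))

/-- Every intermediate table is empty or a sublist of `X`, so `sz X` bounds the accumulator. -/
theorem saturate {X : α → List β} {check : α → List β → β → Bool} (hX : PolyTime X)
    (hc : PolyTime fun y : α × List β × β => check y.1 y.2.1 y.2.2) :
    PolyTime fun x => saturate (X x) (check x) := by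
  refine PolyTimeIn.foldl (f := fun x T _ => (X x).filter fun y => check x T y)
    (B := fun x => sz (X x)) hX (const [])
    (filter (p := fun (z : α × List β × β) y => check z.1 z.2.1 y) (hX.comp fst)
      (hc.comp ((fst.comp fst).pair ((fst.comp (snd.comp fst)).pair snd)))) hX.1 fun x m hm => ?_
  induction m using List.reverseRecOn with
  | nil => exact (two_le_sz (X x))
  | append_singleton m y _ =>
    rw [List.foldl_append]
    exact sz_le_of_sublist List.filter_sublist

theorem entries (hδ : PolyTime δ) (hU : PolyTime U) (hV : PolyTime V) :
    PolyTime fun x => entries (δ x) (U x) (V x) :=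
  flatMap (f := fun x L => ((δ x).map fun (t : RawTransition) => t.top).flatMap fun A => (V x).map fun F => (L, A, F))
    hU (flatMap (f := fun (y : α × List ℕ) A => (V y.1).map fun F => (y.2, A, F))
      (map (f := fun _ (t : RawTransition) => t.top) (hδ.comp fst) (top snd))
      (map (f := fun (y : (α × List ℕ) × ℕ) F => (y.1.2, y.2, F)) (hV.comp (fst.comp fst))
        ((snd.comp (fst.comp fst)).pair ((snd.comp fst).pair snd))))

theorem popTable (hδ : PolyTime δ) (hU : PolyTime U) (hV : PolyTime V) :
    PolyTime fun x => popTable (δ x) (U x) (V x) :=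
  saturate (check := fun x T y => _root_.popCheck (δ x) T y) (entries hδ hU hV)
    (popCheck (hδ.comp fst) (fst.comp snd) (snd.comp snd))

theorem winTable (hδ : PolyTime δ) (hs : PolyTime s) (hbot : PolyTime bot) (hU : PolyTime U)
    (hT : PolyTime T) : PolyTime fun x => winTable (δ x) (s x) (bot x) (U x) (T x) :=
  saturate (check := fun x G L => _root_.winCheck (δ x) (s x) (bot x) (T x) G L) hU
    (winCheck (hδ.comp fst) (hs.comp fst) (hbot.comp fst) (hT.comp fst) (fst.comp snd)
      (snd.comp snd))

variable {r : α → RawInstance}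

theorem raw_init (h : PolyTime r) : PolyTime fun x => (r x).init := fst.comp h

theorem raw_final (h : PolyTime r) : PolyTime fun x => (r x).final := fst.comp (snd.comp h)

theorem raw_bot (h : PolyTime r) : PolyTime fun x => (r x).bot := fst.comp (snd.comp (snd.comp h))

theorem raw_δ (h : PolyTime r) : PolyTime fun x => (r x).δ :=
  fst.comp (snd.comp (snd.comp (snd.comp (snd.comp (snd.comp (snd.comp h))))))

theorem states (h : PolyTime r) : PolyTime fun x => (r x).states :=
  append (raw_init h) (map (f := fun _ (t : RawTransition) => t.tgt) (raw_δ h) (tgt snd))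

theorem answerWith : PolyTime RawInstance.answerWith :=
  contains (winTable (raw_δ fst) (raw_final fst) (raw_bot fst) (fst.comp snd)
    (popTable (raw_δ fst) (fst.comp snd) (snd.comp snd))) (raw_init fst)

end PolyTime

/-! ### Enumerating lists of bounded length -/

section

variable {α β γ ι : Type}

theorem listsUpTo_append (X : List β) (l : List ι) (i : ι) :
    listsUpTo X (l ++ [i]) = [] :: X.flatMap fun x => (listsUpTo X l).map fun m => x :: m := by
  simp [listsUpTo, List.foldl_append]

theorem mem_listsUpTo {X : List β} {l : List ι} {m : List β} :
    m ∈ listsUpTo X l ↔ m.length ≤ l.length ∧ ∀ x ∈ m, x ∈ X := by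
  induction l using List.reverseRecOn generalizing m with
  | nil => cases m <;> simp [listsUpTo]
  | append_singleton l i ih =>
    rw [listsUpTo_append]
    cases m with
    | nil => simp
    | cons x m => simp [ih]; tauto

theorem length_listsUpTo_le (X : List β) (l : List ι) :
    (listsUpTo X l).length ≤ (X.length + 1) ^ l.length := by
  induction l using List.reverseRecOn with
  | nil => simp [listsUpTo]
  | append_singleton l i ih =>
    have h₁ := Nat.mul_le_mul_left X.length ih
    have h₂ := Nat.one_le_pow l.length (X.length + 1) (by omega)
    simp only [listsUpTo_append, List.length_cons, List.length_flatMap, List.length_map,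
      List.map_const', List.sum_replicate, smul_eq_mul, List.length_append, List.length_nil,
      pow_succ, Nat.mul_add, Nat.mul_comm _ X.length]
    omega

variable [Enc α] [Enc β] [Enc γ] [Enc ι]

omit [Enc ι] in
theorem sz_listsUpTo_le (X : List β) (l : List ι) :
    sz (listsUpTo X l) ≤ 2 + (X.length + 1) ^ l.length * (2 + l.length * sz X) :=
  sz_le_of_forall (length_listsUpTo_le X l) fun _ hm =>
    sz_le_of_forall (mem_listsUpTo.1 hm).1 fun _ hx => sz_le_of_mem ((mem_listsUpTo.1 hm).2 _ hx)

theorem PolyTimeIn.comp_of_measure {N : α → ℕ} {M : β → ℕ} {f : α → β} {g : β → γ}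
    (hg : PolyTimeIn M g) (hf : PolyTimeIn N f) (hM : PolyBdd N fun a => M (f a)) :
    PolyTimeIn N fun a => g (f a) := by
  have comp : ∀ {h : β → ℕ}, PolyBdd M h → PolyBdd N fun a => h (f a) := fun ⟨c, hc⟩ =>
    ((hM.add hf.1).pow c).mono fun a => hc (f a)
  obtain ⟨-, T, hT, hT'⟩ := hf
  obtain ⟨hg, U, hU, hU'⟩ := hg
  exact ⟨comp hg, _, hT.comp hU, hT'.add (comp hU')⟩

theorem PolyTimeIn.of_polyTime {N : α → ℕ} {f : α → β} (hf : PolyTime f) : PolyTimeIn N f :=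
  hf.comp (.of_expr .var 2 (fun _ => le_rfl) (fun _ _ _ h => h) .size)

/-- The measure is a bound for the number of lists produced; the accumulator after reading a prefix
`m` is `listsUpTo X m`, which obeys the same bound. -/
theorem polyTimeIn_listsUpTo :
    PolyTimeIn (fun x : List β × List ι => (x.1.length + 1) ^ x.2.length)
      fun x => listsUpTo x.1 x.2 := by
  have h₁ : PolyBdd (fun x : List β × List ι => (x.1.length + 1) ^ x.2.length)
      fun x => sz x.1 := PolyBdd.size.mono fun x => by
    have := sz_pair x.1 x.2
    simp only [Prod.mk.eta] at this
    omega
  have h₂ : PolyBdd (fun x : List β × List ι => (x.1.length + 1) ^ x.2.length)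
      fun x => x.2.length := PolyBdd.size.mono fun x => by
    have := sz_pair x.1 x.2
    have := length_lt_sz x.2
    simp only [Prod.mk.eta] at *
    omega
  refine PolyTimeIn.foldl (f := fun (x : List β × List ι) E _ => [] :: x.1.flatMap fun y =>
      E.map fun m => y :: m)
    (B := fun x => 2 + (x.1.length + 1) ^ x.2.length * (2 + x.2.length * sz x.1))
    (.of_polyTime PolyTime.snd) (.of_polyTime (PolyTime.const _)) (PolyTime.list_cons.comp
      ((PolyTime.const []).pair (PolyTime.flatMap
        (f := fun (x : (List β × List ι) × List (List β) × ι) y => x.2.1.map fun m => y :: m)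
        (PolyTime.fst.comp PolyTime.fst)
        (PolyTime.map
          (f := fun (z : ((List β × List ι) × List (List β) × ι) × β) m => z.2 :: m)
          (PolyTime.fst.comp (PolyTime.snd.comp PolyTime.fst))
          (PolyTime.list_cons.comp ((PolyTime.snd.comp PolyTime.fst).pair PolyTime.snd))))))
    ((PolyBdd.const 2).add (PolyBdd.measure.mul ((PolyBdd.const 2).add (h₂.mul h₁))))
    fun x m hm => (sz_listsUpTo_le x.1 m).trans ?_
  have := hm.length_le
  gcongr
  omega

end

/-! ### The number of candidates, and the running time of the whole algorithm -/

namespace RawInstance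

/-- The measure of the running time. -/
def measure (r : RawInstance) : ℕ := sz r ^ (r.init.length + 1) ^ 2

theorem polyBdd_length_states :
    ∃ c, ∀ r : RawInstance, r.states.length + 1 ≤ sz r ^ c := by
  obtain ⟨c, hc⟩ := (PolyTime.states PolyTime.id).1
  exact ⟨c, fun r => (length_lt_sz _).trans_le (by simpa using hc r)⟩

theorem polyTimeIn_stateLists : PolyTimeIn measure stateLists := by
  refine polyTimeIn_listsUpTo.comp_of_measure
    (.of_polyTime ((PolyTime.states PolyTime.id).pair (PolyTime.raw_init PolyTime.id))) ?_
  obtain ⟨c, hc⟩ := polyBdd_length_states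
  refine (PolyBdd.measure.pow c).mono fun r => (Nat.pow_le_pow_left (hc r) _).trans ?_
  rw [measure, ← pow_mul, ← pow_mul, Nat.mul_comm]
  refine Nat.pow_le_pow_right (by have := two_le_sz r; omega) (Nat.mul_le_mul_right _ ?_)
  nlinarith

theorem polyTimeIn_families : PolyTimeIn measure families := by
  refine polyTimeIn_listsUpTo.comp_of_measure
    (polyTimeIn_stateLists.pair (.of_polyTime (PolyTime.raw_init PolyTime.id))) ?_
  obtain ⟨c, hc⟩ := polyBdd_length_states
  refine (PolyBdd.measure.pow (c + 1)).mono fun r => ?_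
  have h2 := two_le_sz r
  -- There are at most `sz r ^ (c * k)` state lists; choosing up to `k` of them multiplies the
  -- exponent by `k` again, which is where the square in `measure` comes from.
  have h₁ : r.stateLists.length + 1 ≤ sz r ^ ((c + 1) * (r.init.length + 1)) := by
    have h := (length_listsUpTo_le r.states r.init).trans (Nat.pow_le_pow_left (hc r) _)
    rw [← pow_mul] at h
    have h₃ := Nat.one_le_pow (c * r.init.length) (sz r) (by omega)
    calc r.stateLists.length + 1 ≤ sz r ^ (c * r.init.length) * 2 := by
          have : r.stateLists.length ≤ _ := h
          omega
      _ ≤ sz r ^ (c * r.init.length) * sz r := Nat.mul_le_mul_left _ h2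
      _ = sz r ^ (c * r.init.length + 1) := (pow_succ _ _).symm
      _ ≤ _ := Nat.pow_le_pow_right (by omega) (by nlinarith)
  refine (Nat.pow_le_pow_left h₁ _).trans ?_
  rw [measure, ← pow_mul, ← pow_mul]
  exact Nat.pow_le_pow_right (by omega) (by nlinarith [Nat.zero_le (c * r.init.length)])

theorem polyTimeIn_answer : PolyTimeIn measure answer :=
  PolyTime.answerWith.comp
    ((PolyTimeIn.of_polyTime PolyTime.id).pair (polyTimeIn_stateLists.pair polyTimeIn_families))

end RawInstance

/-! ## Correctness of the algorithm -/

/-! ### Least fixed points by bounded iteration -/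

section saturate

variable {β : Type} {X : List β} {check : List β → β → Bool}

theorem saturate_induction {P : β → Prop}
    (hP : ∀ T : List β, (∀ x ∈ T, P x) → ∀ x ∈ X, check T x → P x) :
    ∀ x ∈ saturate X check, P x := by
  have h : ∀ (l : List β) (T : List β), (∀ x ∈ T, P x) →
      ∀ x ∈ l.foldl (fun T _ => X.filter fun x => check T x) T, P x := by
    intro l
    induction l with
    | nil => exact fun T h => h
    | cons y l ih =>
      exact fun T h => ih _ fun x hx => hP T h x (List.mem_filter.1 hx).1 (List.mem_filter.1 hx).2
  exact h X [] (by simp)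

/-- A table produced by monotone rules is closed under them. -/
theorem mem_saturate_of_check
    (hmono : ∀ (T T' : List β) (x : β), T ⊆ T' → check T x → check T' x)
    {x : β} (hx : x ∈ X) (h : check (saturate X check) x) : x ∈ saturate X check := by
  let step : List β → List β := fun T => X.filter fun x => check T x
  have hstep : ∀ T T', T.Sublist T' → (step T).Sublist (step T') := fun T T' h =>
    List.monotone_filter_right X fun x => hmono T T' x h.subset
  have hsub : ∀ n, (step^[n] []).Sublist (step^[n + 1] []) := by
    intro n
    induction n with
    | zero => exact List.nil_sublist _
    | succ n ih =>
      rw [Function.iterate_succ_apply', Function.iterate_succ_apply' step (n + 1)]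
      exact hstep _ _ ih
  -- The iterates increase as sublists: each round adds an element until the chain becomes
  -- stationary.
  have hgrow : ∀ n, n ≤ (step^[n] []).length ∨ step^[n + 1] [] = step^[n] [] := by
    intro n
    induction n with
    | zero => exact .inl (Nat.zero_le _)
    | succ n ih =>
      by_cases heq : step^[n + 1] [] = step^[n] []
      · right
        rw [Function.iterate_succ_apply' step (n + 1), heq, ← Function.iterate_succ_apply' step n, heq]
      · left
        refine (ih.resolve_right heq).trans_lt ?_
        exact lt_of_le_of_ne (hsub n).length_le fun h => heq ((hsub n).eq_of_length h).symm
  have hsat : ∀ (l T : List β),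
      l.foldl (fun T _ => X.filter fun x => check T x) T = step^[l.length] T := by
    intro l
    induction l with
    | nil => exact fun _ => rfl
    | cons y l ih => exact fun T => ih _
  have hX : saturate X check = step^[X.length] [] := hsat X []
  have hmem : x ∈ step (saturate X check) := List.mem_filter.2 ⟨hx, h⟩
  rw [hX] at hmem ⊢
  -- Either the table has as many elements as `X` and is therefore all of `X`, or it is already a
  -- fixed point.
  rcases hgrow X.length with hle | heq
  · have hs : (step^[X.length] []).Sublist X := by
      cases hl : X.length with
      | zero => exact List.nil_sublist _
      | succ n => rw [Function.iterate_succ_apply']; exact List.filter_sublist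
    rwa [hs.eq_of_length (le_antisymm hs.length_le hle)]
  · rwa [← heq, Function.iterate_succ_apply']

end saturate

/-! ### Popping a word by chaining table entries -/

section popList

variable {T T' : List Entry} {G G' : List (List ℕ)} {L : List ℕ} {γ : List ℕ}

theorem mem_popList_cons {B : ℕ} :
    L ∈ popList T (B :: γ) G ↔ ∃ F, (L, B, F) ∈ T ∧ ∀ M ∈ F, M ∈ popList T γ G := by
  simp only [popList, List.foldr_cons, List.mem_map, List.mem_filter, Bool.and_eq_true,
    beq_iff_eq, List.all_eq_true, List.contains_iff_mem]
  constructor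
  · rintro ⟨⟨L', B', F⟩, ⟨h₁, rfl, h₂⟩, rfl⟩
    exact ⟨F, h₁, h₂⟩
  · rintro ⟨F, h₁, h₂⟩
    exact ⟨(L, B, F), ⟨h₁, rfl, h₂⟩, rfl⟩

theorem popList_append (γ' : List ℕ) :
    popList T (γ ++ γ') G = popList T γ (popList T γ' G) := by
  simp [popList]

theorem popList_mono (hT : T ⊆ T') (hG : G ⊆ G') : popList T γ G ⊆ popList T' γ G' := by
  induction γ with
  | nil => exact hG
  | cons B γ ih =>
    intro L hL
    obtain ⟨F, h₁, h₂⟩ := mem_popList_cons.1 hL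
    exact mem_popList_cons.2 ⟨F, hT h₁, fun M hM => ih (h₂ M hM)⟩

end popList

/-! ### Successor lists and their total length -/

section

variable {δ : List RawTransition} {L : List ℕ} {a A s bot : ℕ} {c : List ℕ × List ℕ}

theorem mem_moves {t : RawTransition} :
    t ∈ moves δ L a A ↔ t ∈ δ ∧ t.src ∈ L ∧ t.inp = a ∧ t.top = A := by
  simp [moves]

theorem mem_targets {R : List RawTransition} {γ : List ℕ} {q : ℕ} :
    q ∈ targets R γ ↔ ∃ t ∈ R, t.push = γ ∧ t.tgt = q := by
  simp only [targets, List.mem_map, List.mem_filter, beq_iff_eq, and_assoc]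

theorem mem_succs :
    c ∈ succs δ L a A ↔ ∃ t ∈ moves δ L a A, (targets (moves δ L a A) t.push, t.push) = c := by
  simp only [succs, List.mem_map]

theorem fst_ne_nil_of_mem_succs (h : c ∈ succs δ L a A) : c.1 ≠ [] := by
  obtain ⟨t, ht, rfl⟩ := mem_succs.1 h
  exact List.ne_nil_of_mem (mem_targets.2 ⟨t, ht, rfl, rfl⟩)

theorem exists_of_mem_succs (h : c ∈ succs δ L a A) :
    ∃ t ∈ δ, t.inp = a ∧ t.top = A ∧ t.push = c.2 := by
  obtain ⟨t, ht, rfl⟩ := mem_succs.1 h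
  exact ⟨t, (mem_moves.1 ht).1, (mem_moves.1 ht).2.2.1, (mem_moves.1 ht).2.2.2, rfl⟩

theorem mem_targets_of_mem_succs (h : c ∈ succs δ L a A) {q : ℕ} (hq : q ∈ c.1) :
    q ∈ δ.map fun t => t.tgt := by
  obtain ⟨t, ht, rfl⟩ := mem_succs.1 h
  obtain ⟨u, hu, -, rfl⟩ := mem_targets.1 hq
  exact List.mem_map_of_mem (mem_moves.1 hu).1

/-- Each transition pushes a single word and so is counted for at most one member of `D`. Repeated
targets are kept in `targets`, and the bound still holds. -/
theorem sum_length_targets_le (R : List RawTransition) {D : List (List ℕ)} (hD : D.Nodup) :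
    (D.map fun γ => (targets R γ).length).sum ≤ R.length := by
  induction R with
  | nil => simp [targets]
  | cons t R ih =>
    have h : ∀ γ, (targets (t :: R) γ).length =
        (targets R γ).length + if t.push = γ then 1 else 0 := by
      intro γ
      by_cases h : t.push = γ <;> simp [targets, h]
    have h' : (D.map fun γ => if t.push = γ then 1 else 0).sum ≤ 1 := by
      refine le_of_eq_of_le ?_ (List.nodup_iff_count_le_one.1 hD t.push)
      clear hD ih
      induction D with
      | nil => rfl
      | cons γ D ih =>
        rw [List.map_cons, List.sum_cons, ih, List.count_cons, add_comm]
        simp only [beq_iff_eq, @eq_comm _ γ]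
    simp only [h, List.sum_map_add, List.length_cons]
    omega

/-- `succs` repeats a class once for each of its transitions; the total length is only bounded after
each class is listed once. -/
theorem exists_nodup_succs (δ : List RawTransition) (L : List ℕ) (a A : ℕ) :
    ∃ D : List (List ℕ × List ℕ), (∀ c, c ∈ D ↔ c ∈ succs δ L a A) ∧
      (D.map fun c => c.1.length).sum ≤ (moves δ L a A).length := by
  refine ⟨((moves δ L a A).map fun t => t.push).dedup.map
    fun γ => (targets (moves δ L a A) γ, γ), fun c => ?_, ?_⟩
  · rw [mem_succs]
    simp only [List.mem_map, List.mem_dedup]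
    constructor
    · rintro ⟨_, ⟨t, ht, rfl⟩, rfl⟩
      exact ⟨t, ht, rfl⟩
    · rintro ⟨t, ht, rfl⟩
      exact ⟨_, ⟨t, ht, rfl⟩, rfl⟩
  · rw [List.map_map]
    exact sum_length_targets_le _ (List.nodup_dedup _)

/-- Searching only the letters that occur in transitions loses nothing, because any other letter has
no successors. -/
theorem popCheck_iff {T : List Entry} {x : Entry} :
    popCheck δ T x ↔ ∃ a, succs δ x.1 a x.2.1 ≠ [] ∧
      ∀ c ∈ succs δ x.1 a x.2.1, c.1 ∈ popList T c.2 x.2.2 := by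
  simp only [popCheck, List.any_eq_true, Bool.and_eq_true, Bool.not_eq_true',
    List.isEmpty_eq_false_iff, List.all_eq_true, List.contains_iff_mem]
  refine ⟨fun ⟨a, _, h⟩ => ⟨a, h⟩, fun ⟨a, h⟩ => ⟨a, ?_, h⟩⟩
  obtain ⟨c, hc⟩ := List.exists_mem_of_ne_nil _ h.1
  obtain ⟨t, ht, rfl, -⟩ := exists_of_mem_succs hc
  exact List.mem_map_of_mem ht

theorem winCheck_iff {T : List Entry} {G : List (List ℕ)} :
    winCheck δ s bot T G L ↔ (L ≠ [] ∧ ∀ p ∈ L, p = s) ∨ ∃ a, succs δ L a bot ≠ [] ∧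
      ∀ c ∈ succs δ L a bot, c.1 ∈ popList T c.2.dropLast G := by
  simp only [winCheck, Bool.or_eq_true, List.any_eq_true, Bool.and_eq_true, Bool.not_eq_true',
    List.isEmpty_eq_false_iff, List.all_eq_true, List.contains_iff_mem, beq_iff_eq]
  refine or_congr_right ⟨fun ⟨a, _, h⟩ => ⟨a, h⟩, fun ⟨a, h⟩ => ⟨a, ?_, h⟩⟩
  obtain ⟨c, hc⟩ := List.exists_mem_of_ne_nil _ h.1
  obtain ⟨t, ht, rfl, -⟩ := exists_of_mem_succs hc
  exact List.mem_map_of_mem ht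

/-! ### Soundness of the tables -/

/-- From the list of states `L` and a stack one can force the system, in finitely many steps, into
the state `s` with stack `bot`. -/
inductive Force (δ : List RawTransition) (s bot : ℕ) : List ℕ → List ℕ → Prop
  | leaf {L : List ℕ} (hL : L ≠ []) (hs : ∀ p ∈ L, p = s) : Force δ s bot L [bot]
  | node {L : List ℕ} {A : ℕ} {η : List ℕ} (a : ℕ) (hne : succs δ L a A ≠ [])
      (h : ∀ c ∈ succs δ L a A, Force δ s bot c.1 (c.2 ++ η)) : Force δ s bot L (A :: η)

/-- The entry is true over every stack. -/
def Entry.Valid (δ : List RawTransition) (s bot : ℕ) (x : Entry) : Prop :=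
  ∀ η, (∀ M ∈ x.2.2, Force δ s bot M η) → Force δ s bot x.1 (x.2.1 :: η)

theorem force_of_mem_popList {T : List Entry} (hT : ∀ x ∈ T, Entry.Valid δ s bot x)
    {G : List (List ℕ)} {η : List ℕ} (hG : ∀ M ∈ G, Force δ s bot M η) :
    ∀ {γ L : List ℕ}, L ∈ popList T γ G → Force δ s bot L (γ ++ η)
  | [], _, h => hG _ h
  | B :: γ, L, h => by
    obtain ⟨F, h₁, h₂⟩ := mem_popList_cons.1 h
    exact hT _ h₁ (γ ++ η) fun M hM => force_of_mem_popList hT hG (h₂ M hM)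

/-- Validity quantifies over all stacks `η`, so that entries can be chained: while the top letter of
a word is popped, the rest of the word is part of the stack below. -/
theorem valid_of_mem_popTable {U : List (List ℕ)} {V : List (List (List ℕ))} :
    ∀ x ∈ popTable δ U V, Entry.Valid δ s bot x := by
  refine saturate_induction fun T hT x _ hx η hη => ?_
  obtain ⟨a, h₁, h₂⟩ := popCheck_iff.1 hx
  exact .node a h₁ fun c hc => force_of_mem_popList hT hη (h₂ c hc)

theorem force_of_mem_winTable (hbot : ∀ t ∈ δ, t.top = bot → ∃ γ, t.push = γ ++ [bot])
    {U : List (List ℕ)} {T : List Entry} (hT : ∀ x ∈ T, Entry.Valid δ s bot x) :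
    ∀ L ∈ winTable δ s bot U T, Force δ s bot L [bot] := by
  refine saturate_induction fun G hG L _ hL => ?_
  rcases winCheck_iff.1 hL with ⟨h₁, h₂⟩ | ⟨a, h₁, h₂⟩
  · exact .leaf h₁ h₂
  · refine .node a h₁ fun c hc => ?_
    obtain ⟨t, ht, -, htop, hpush⟩ := exists_of_mem_succs hc
    obtain ⟨γ, hγ⟩ := hbot t ht htop
    have h := force_of_mem_popList hT hG (h₂ c hc)
    have hc₂ : c.2 = γ ++ [bot] := hpush.symm.trans hγ
    rw [hc₂, List.dropLast_concat] at h
    rwa [List.append_nil, hc₂]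

/-! ### Completeness of the tables -/

/-- The entries with nonempty members of `U` whose lengths add up to at most that of the source. -/
def Entry.Small (U : List (List ℕ)) (x : Entry) : Prop :=
  (x.2.2.map List.length).sum ≤ x.1.length ∧ ∀ M ∈ x.2.2, M ≠ [] ∧ M ∈ U

theorem sum_length_flatMap_le {β : Type} {l : List β} {f : β → List (List ℕ)} {w : β → ℕ}
    (h : ∀ x ∈ l, ((f x).map List.length).sum ≤ w x) :
    ((l.flatMap f).map List.length).sum ≤ (l.map w).sum := by
  induction l with
  | nil => simp
  | cons x l ih =>
    have h₁ := ih fun y hy => h y (List.mem_cons_of_mem _ hy)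
    have h₂ := h x List.mem_cons_self
    simp only [List.flatMap_cons, List.map_append, List.sum_append, List.map_cons, List.sum_cons]
    omega

/-- Each member `M` of the family of the first entry is replaced by the small part of `G` that it
needs for the remaining word. Total lengths add up along these replacements, so they never exceed
`|L|`. -/
theorem exists_small_of_mem_popList {U : List (List ℕ)} {T : List Entry}
    (hT : ∀ x ∈ T, Entry.Small U x) {G : List (List ℕ)} {γ : List ℕ} :
    ∀ {L : List ℕ}, L ≠ [] → L ∈ U → L ∈ popList T γ G → ∃ F, (∀ M ∈ F, M ≠ [] ∧ M ∈ U) ∧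
      F ⊆ G ∧ (F.map List.length).sum ≤ L.length ∧ L ∈ popList T γ F := by
  induction γ with
  | nil =>
    intro L hL hU h
    exact ⟨[L], by simp [hL, hU], by simpa using (show L ∈ G from h), by simp,
      List.mem_singleton_self L⟩
  | cons B γ ih =>
    intro L hL hU h
    obtain ⟨F', h₁, h₂⟩ := mem_popList_cons.1 h
    obtain ⟨h₃, h₄⟩ := hT _ h₁
    have h₅ : ∀ M, ∃ F : List (List ℕ), M ∈ F' → (∀ M ∈ F, M ≠ [] ∧ M ∈ U) ∧
        F ⊆ G ∧ (F.map List.length).sum ≤ M.length ∧ M ∈ popList T γ F := by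
      intro M
      by_cases hM : M ∈ F'
      · obtain ⟨F, hF⟩ := ih (h₄ M hM).1 (h₄ M hM).2 (h₂ M hM)
        exact ⟨F, fun _ => hF⟩
      · exact ⟨[], fun h => absurd h hM⟩
    choose f hf using h₅
    refine ⟨F'.flatMap f, fun M hM => ?_, fun M hM => ?_, ?_, mem_popList_cons.2
      ⟨F', h₁, fun M hM => popList_mono (List.Subset.refl _) ?_ (hf M hM).2.2.2⟩⟩
    · obtain ⟨N, hN, hM⟩ := List.mem_flatMap.1 hM
      exact (hf N hN).1 M hM
    · obtain ⟨N, hN, hM⟩ := List.mem_flatMap.1 hM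
      exact (hf N hN).2.1 hM
    · exact (sum_length_flatMap_le fun N hN => (hf N hN).2.2.1).trans h₃
    · exact fun N hN => List.mem_flatMap.2 ⟨M, hM, hN⟩

theorem mem_states_of_mem_succs {r : RawInstance} (h : c ∈ succs r.δ L a A) {q : ℕ}
    (hq : q ∈ c.1) : q ∈ r.states :=
  List.mem_append_right _ (mem_targets_of_mem_succs h hq)

theorem mem_stateLists_of_mem_succs {r : RawInstance}
    (hdet : ∀ L a A, (moves r.δ L a A).length ≤ L.length) (hL : L ∈ r.stateLists)
    (h : c ∈ succs r.δ L a A) : c.1 ∈ r.stateLists := by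
  refine mem_listsUpTo.2 ⟨?_, fun q hq => mem_states_of_mem_succs h hq⟩
  obtain ⟨D, hD, hD'⟩ := exists_nodup_succs r.δ L a A
  exact (List.single_le_sum (by simp) _ (List.mem_map_of_mem (f := fun c => c.1.length)
    ((hD c).2 h))).trans (hD'.trans ((hdet L a A).trans (mem_listsUpTo.1 hL).1))

-- Any tables closed under the two rules contain all that a strategy can force. The induction is
-- over the strategy, and its claim is strengthened to popping with small entries only: this is what
-- allows new families to be cut down and found among the finitely many candidates.
open Classical in
theorem mem_popList_of_force {r : RawInstance}
    (hdet : ∀ L a A, (moves r.δ L a A).length ≤ L.length)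
    (hbot : ∀ t ∈ r.δ, t.top = r.bot → ∃ γ, t.push = γ ++ [r.bot])
    {T : List Entry} {G : List (List ℕ)}
    (hT : ∀ x ∈ entries r.δ r.stateLists r.families, popCheck r.δ T x → x ∈ T)
    (hG : ∀ L ∈ r.stateLists, winCheck r.δ r.final r.bot T G L → L ∈ G) {ζ : List ℕ}
    (h : Force r.δ r.final r.bot L ζ) : ∀ γ, ζ = γ ++ [r.bot] → L ≠ [] → L ∈ r.stateLists →
      L ∈ popList (T.filter fun x => decide (x.Small r.stateLists)) γ G := by
  set T' := T.filter fun x => decide (x.Small r.stateLists) with hT'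
  have hsub : T' ⊆ T := List.filter_sublist.subset
  induction h with
  | @leaf L hL hs =>
    intro γ hγ _ hU
    cases γ with
    | nil => exact hG L hU (winCheck_iff.2 (.inl ⟨hL, hs⟩))
    | cons B γ => simp at hγ
  | @node L A η a hne _ ih =>
    intro γ hγ hL hU
    have hstep : ∀ c ∈ succs r.δ L a A, c.1 ≠ [] ∧ c.1 ∈ r.stateLists := fun c hc =>
      ⟨fst_ne_nil_of_mem_succs hc, mem_stateLists_of_mem_succs hdet hU hc⟩
    cases γ with
    | nil =>
      obtain ⟨rfl, rfl⟩ := List.cons_eq_cons.1 hγ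
      refine hG L hU (winCheck_iff.2 (.inr ⟨a, hne, fun c hc => ?_⟩))
      obtain ⟨t, ht, -, htop, hpush⟩ := exists_of_mem_succs hc
      obtain ⟨γ, hγ⟩ := hbot t ht htop
      have hc₂ : c.2 = γ ++ [r.bot] := hpush.symm.trans hγ
      rw [hc₂, List.dropLast_concat]
      exact popList_mono hsub (List.Subset.refl _)
        (ih c hc γ (by rw [List.append_nil, hc₂]) (hstep c hc).1 (hstep c hc).2)
    | cons B γ =>
      obtain ⟨rfl, rfl⟩ := List.cons_eq_cons.1 hγ
      have h₁ : ∀ c, ∃ F : List (List ℕ), c ∈ succs r.δ L a A →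
          (∀ M ∈ F, M ≠ [] ∧ M ∈ r.stateLists) ∧ F ⊆ popList T' γ G ∧
          (F.map List.length).sum ≤ c.1.length ∧ c.1 ∈ popList T' c.2 F := by
        intro c
        by_cases hc : c ∈ succs r.δ L a A
        -- The strategy from `c` pops the pushed word and then `γ`. Splitting there gives the lists
        -- in which the pushed word has just been removed, of which a small family `F` suffices.
        · have := ih c hc (c.2 ++ γ) (List.append_assoc _ _ _).symm (hstep c hc).1 (hstep c hc).2
          rw [popList_append] at this
          obtain ⟨F, hF⟩ := exists_small_of_mem_popList
            (fun x hx => of_decide_eq_true (List.mem_filter.1 hx).2) (hstep c hc).1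
            (hstep c hc).2 this
          exact ⟨F, fun _ => hF⟩
        · exact ⟨[], fun h => absurd h hc⟩
      choose f hf using h₁
      obtain ⟨D, hD, hD'⟩ := exists_nodup_succs r.δ L a A
      -- The union of the small families, one per class, serves as the family for `A`; its total
      -- length is at most that of all successors, hence at most `|L|`.
      have hsum : ((D.flatMap f).map List.length).sum ≤ L.length :=
        (sum_length_flatMap_le fun c hc => (hf c ((hD c).1 hc)).2.2.1).trans
          (hD'.trans (hdet L a A))
      have hmem : ∀ M ∈ D.flatMap f, M ≠ [] ∧ M ∈ r.stateLists := fun M hM => by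
        obtain ⟨c, hc, hM⟩ := List.mem_flatMap.1 hM
        exact (hf c ((hD c).1 hc)).1 M hM
      refine mem_popList_cons.2 ⟨D.flatMap f, List.mem_filter.2 ⟨hT _ ?_ (popCheck_iff.2
        ⟨a, hne, fun c hc => popList_mono hsub ?_ (hf c hc).2.2.2⟩),
        decide_eq_true ⟨hsum, hmem⟩⟩, fun M hM => ?_⟩
      · obtain ⟨c, hc⟩ := List.exists_mem_of_ne_nil _ hne
        obtain ⟨t, ht, -, htop, -⟩ := exists_of_mem_succs hc
        simp only [entries, List.mem_flatMap, List.mem_map]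
        refine ⟨L, hU, A, ⟨t, ht, htop⟩, D.flatMap f, mem_listsUpTo.2 ⟨?_, fun M hM =>
          (hmem M hM).2⟩, rfl⟩
        -- Nonempty members make the number of lists at most their total length, so the family has
        -- at most `k` members and was enumerated.
        have := List.length_le_sum_of_one_le ((D.flatMap f).map List.length) (by
          intro n hn
          obtain ⟨M, hM, rfl⟩ := List.mem_map.1 hn
          exact List.length_pos_of_ne_nil (hmem M hM).1)
        rw [List.length_map] at this
        exact this.trans (hsum.trans (mem_listsUpTo.1 hU).1)
      · exact fun M hM => List.mem_flatMap.2 ⟨c, (hD c).2 hc, hM⟩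
      · obtain ⟨c, hc, hM⟩ := List.mem_flatMap.1 hM
        exact (hf c ((hD c).1 hc)).2.1 hM

theorem RawInstance.answer_iff {r : RawInstance}
    (hdet : ∀ L a A, (moves r.δ L a A).length ≤ L.length)
    (hbot : ∀ t ∈ r.δ, t.top = r.bot → ∃ γ, t.push = γ ++ [r.bot]) (hinit : r.init ≠ []) :
    r.answer ↔ Force r.δ r.final r.bot r.init [r.bot] := by
  have hU : r.init ∈ r.stateLists :=
    mem_listsUpTo.2 ⟨le_rfl, fun _ h => List.mem_append_left _ h⟩
  simp only [RawInstance.answer, RawInstance.answerWith, List.contains_iff_mem]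
  refine ⟨force_of_mem_winTable hbot valid_of_mem_popTable _, fun h => ?_⟩
  refine mem_popList_of_force (T := popTable r.δ r.stateLists r.families)
    (G := winTable r.δ r.final r.bot r.stateLists (popTable r.δ r.stateLists r.families))
    hdet hbot (fun x hx => ?_) (fun L hL => ?_) h [] rfl hinit hU
  · refine mem_saturate_of_check (fun T T' x hT hx => ?_) hx
    obtain ⟨a, h₁, h₂⟩ := popCheck_iff.1 hx
    exact popCheck_iff.2 ⟨a, h₁, fun c hc => popList_mono hT (List.Subset.refl _) (h₂ c hc)⟩
  · refine mem_saturate_of_check (fun G G' L hG hL => ?_) hL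
    refine winCheck_iff.2 ((winCheck_iff.1 hL).imp_right ?_)
    exact fun ⟨a, h₁, h₂⟩ =>
      ⟨a, h₁, fun c hc => popList_mono (List.Subset.refl _) hG (h₂ c hc)⟩

end

/-! ## From synchronisers to numbered instances -/

/-- A transition with its components replaced by numbers. -/
def Transition.toRaw {Q Inp Stk : Type} (fQ : Q → ℕ) (fI : Inp → ℕ) (fS : Stk → ℕ)
    (t : Transition Q Inp Stk) : RawTransition :=
  (fQ t.src, fI t.inp, fS t.top, fQ t.tgt, t.push.map fS, ())

/-- The list `L` consists of the numbers of the members of `S`. -/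
def Represents {Q : Type} (fQ : Q → ℕ) (S : Set Q) (L : List ℕ) : Prop :=
  ∀ i, i ∈ L ↔ ∃ q ∈ S, fQ q = i

section

variable {Q Inp Stk : Type} {fQ : Q → ℕ} {fI : Inp → ℕ} {fS : Stk → ℕ}
  {P : PDA Q Inp Stk} {l : List (Transition Q Inp Stk)} {S : Set Q} {L : List ℕ} {a : Inp} {A : Stk}

theorem Transition.toRaw_injective (hQ : fQ.Injective) (hI : fI.Injective) (hS : fS.Injective) :
    Function.Injective (Transition.toRaw fQ fI fS) := by
  rintro ⟨p, a, A, q, γ⟩ ⟨p', a', A', q', γ'⟩ h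
  simp only [Transition.toRaw, Prod.mk.injEq, hQ.eq_iff, hI.eq_iff, hS.eq_iff,
    (List.map_injective_iff.2 hS).eq_iff] at h
  obtain ⟨rfl, rfl, rfl, rfl, rfl, -⟩ := h
  rfl

theorem mem_moves_toRaw (hQ : fQ.Injective) (hI : fI.Injective) (hS : fS.Injective)
    (hl : ∀ t, t ∈ l ↔ t ∈ P.δ) (hL : Represents fQ S L) {u : RawTransition} :
    u ∈ moves (l.map (Transition.toRaw fQ fI fS)) L (fI a) (fS A) ↔
      ∃ t ∈ P.trans S a A, t.toRaw fQ fI fS = u := by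
  rw [mem_moves, List.mem_map]
  constructor
  · rintro ⟨⟨t, ht, rfl⟩, h₁, h₂, h₃⟩
    obtain ⟨q, hq, hq'⟩ := (hL _).1 h₁
    exact ⟨t, ⟨(hl t).1 ht, hQ hq' ▸ hq, hI h₂, hS h₃⟩, rfl⟩
  · rintro ⟨t, ⟨h₁, h₂, h₃, h₄⟩, rfl⟩
    exact ⟨⟨t, (hl t).2 h₁, rfl⟩, (hL _).2 ⟨_, h₂, rfl⟩, congrArg fI h₃, congrArg fS h₄⟩

/-- A class is determined by the word that any one of its members pushes, so successors can be
indexed by transitions, as `succs` does. -/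
theorem PDA.mem_succ_iff {η : List Stk} {c : PDA.PseudoConf Q Stk} :
    c ∈ P.succ S A η a ↔ ∃ t ∈ P.trans S a A,
      c = ({q | ∃ u ∈ P.trans S a A, u.push = t.push ∧ u.tgt = q}, t.push ++ η) := by
  have hnext : ∀ t : P.trans S a A, PDA.next {u | (P.indist S a A) u t} =
      {q | ∃ u ∈ P.trans S a A, u.push = t.1.push ∧ u.tgt = q} := by
    intro t
    ext q
    constructor
    · rintro ⟨u, ⟨γ, h₁, h₂⟩, rfl⟩
      exact ⟨u.1, u.2, h₁.trans h₂.symm, rfl⟩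
    · rintro ⟨u, hu, h, rfl⟩
      exact ⟨⟨u, hu⟩, ⟨_, h, rfl⟩, rfl⟩
  constructor
  · rintro ⟨_, ⟨t, rfl⟩, γ, hγ, rfl⟩
    refine ⟨t.1, t.2, ?_⟩
    rw [hnext, hγ t ⟨_, rfl, rfl⟩]
  · rintro ⟨t, ht, rfl⟩
    refine ⟨_, ⟨⟨t, ht⟩, rfl⟩, t.push, ?_, ?_⟩
    · rintro u ⟨γ, h₁, h₂⟩
      exact h₁.trans h₂.symm
    · rw [hnext]

theorem represents_targets (hQ : fQ.Injective) (hI : fI.Injective) (hS : fS.Injective)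
    (hl : ∀ t, t ∈ l ↔ t ∈ P.δ) (hL : Represents fQ S L) (γ : List Stk) :
    Represents fQ {q | ∃ u ∈ P.trans S a A, u.push = γ ∧ u.tgt = q}
      (targets (moves (l.map (Transition.toRaw fQ fI fS)) L (fI a) (fS A)) (γ.map fS)) := by
  intro i
  simp only [mem_targets, mem_moves_toRaw hQ hI hS hl hL]
  constructor
  · rintro ⟨_, ⟨t, ht, rfl⟩, h, rfl⟩
    exact ⟨t.tgt, ⟨t, ht, List.map_injective_iff.2 hS h, rfl⟩, rfl⟩
  · rintro ⟨_, ⟨t, ht, rfl, rfl⟩, rfl⟩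
    exact ⟨_, ⟨t, ht, rfl⟩, rfl, rfl⟩

theorem exists_mem_succs (hQ : fQ.Injective) (hI : fI.Injective) (hS : fS.Injective)
    (hl : ∀ t, t ∈ l ↔ t ∈ P.δ) (hL : Represents fQ S L) {η : List Stk} {c : PDA.PseudoConf Q Stk}
    (hc : c ∈ P.succ S A η a) :
    ∃ m ∈ succs (l.map (Transition.toRaw fQ fI fS)) L (fI a) (fS A),
      Represents fQ c.1 m.1 ∧ c.2.map fS = m.2 ++ η.map fS := by
  obtain ⟨t, ht, rfl⟩ := PDA.mem_succ_iff.1 hc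
  exact ⟨_, mem_succs.2 ⟨t.toRaw fQ fI fS, (mem_moves_toRaw hQ hI hS hl hL).2 ⟨t, ht, rfl⟩, rfl⟩,
    represents_targets hQ hI hS hl hL t.push, List.map_append⟩

theorem exists_mem_succ (hQ : fQ.Injective) (hI : fI.Injective) (hS : fS.Injective)
    (hl : ∀ t, t ∈ l ↔ t ∈ P.δ) (hL : Represents fQ S L) (η : List Stk) {m : List ℕ × List ℕ}
    (hm : m ∈ succs (l.map (Transition.toRaw fQ fI fS)) L (fI a) (fS A)) :
    ∃ c ∈ P.succ S A η a, Represents fQ c.1 m.1 ∧ c.2.map fS = m.2 ++ η.map fS := by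
  obtain ⟨u, hu, rfl⟩ := mem_succs.1 hm
  obtain ⟨t, ht, rfl⟩ := (mem_moves_toRaw hQ hI hS hl hL).1 hu
  exact ⟨_, PDA.mem_succ_iff.2 ⟨t, ht, rfl⟩, represents_targets hQ hI hS hl hL t.push,
    List.map_append⟩

theorem force_of_isSuper (hQ : fQ.Injective) (hI : fI.Injective) (hS : fS.Injective)
    (hl : ∀ t, t ∈ l ↔ t ∈ P.δ) {s : Q} {c : PDA.PseudoConf Q Stk} (T : P.Synchroniser s c)
    (hT : T.IsSuper) : ∀ L, Represents fQ c.1 L →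
      Force (l.map (Transition.toRaw fQ fI fS)) (fQ s) (fS P.bot) L (c.2.map fS) := by
  induction T with
  | leaf η =>
    intro L hL
    rw [show η = [P.bot] from hT]
    refine .leaf (List.ne_nil_of_mem ((hL (fQ s)).2 ⟨s, rfl, rfl⟩)) fun i hi => ?_
    obtain ⟨_, rfl, rfl⟩ := (hL i).1 hi
    rfl
  | node S A η a hne child ih =>
    intro L hL
    refine .node (fI a) ?_ fun m hm => ?_
    · obtain ⟨c, hc⟩ := hne
      obtain ⟨m, hm, -⟩ := exists_mem_succs hQ hI hS hl hL hc
      exact List.ne_nil_of_mem hm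
    · obtain ⟨c, hc, h₁, h₂⟩ := exists_mem_succ hQ hI hS hl hL η hm
      rw [← h₂]
      exact ih ⟨c, hc⟩ (hT ⟨c, hc⟩) m.1 h₁

theorem superSync_of_force (hQ : fQ.Injective) (hI : fI.Injective) (hS : fS.Injective)
    (hl : ∀ t, t ∈ l ↔ t ∈ P.δ) {s : Q} {ζ : List ℕ}
    (h : Force (l.map (Transition.toRaw fQ fI fS)) (fQ s) (fS P.bot) L ζ) :
    ∀ (S : Set Q) (γ : List Stk), γ.map fS = ζ → Represents fQ S L → P.SuperSync S γ s := by
  induction h with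
  | @leaf L hne hs =>
    intro S γ hγ hL
    have hγ' : γ = [P.bot] := List.map_injective_iff.2 hS hγ
    have hS' : S = {s} := by
      obtain ⟨i, hi⟩ := List.exists_mem_of_ne_nil _ hne
      obtain ⟨p, hp, rfl⟩ := (hL i).1 hi
      refine Set.eq_singleton_iff_unique_mem.2 ⟨hQ (hs _ hi) ▸ hp, fun q hq => ?_⟩
      exact hQ (hs _ ((hL _).2 ⟨q, hq, rfl⟩))
    subst hγ' hS'
    exact ⟨.leaf _, rfl⟩
  | @node L A η a hne _ ih =>
    intro S γ hγ hL
    obtain ⟨A, γ, rfl, rfl, rfl⟩ := List.map_eq_cons_iff.1 hγ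
    obtain ⟨m, hm⟩ := List.exists_mem_of_ne_nil _ hne
    -- The number `a` is a priori arbitrary; since some successor exists, a transition shows that it
    -- numbers a letter.
    obtain ⟨u, hu, rfl, -⟩ := exists_of_mem_succs hm
    obtain ⟨t, -, rfl⟩ := List.mem_map.1 hu
    have hchild : ∀ c : P.succ S A γ t.inp, P.SuperSync c.1.1 c.1.2 s := fun c => by
      obtain ⟨m, hm, h₁, h₂⟩ := exists_mem_succs hQ hI hS hl hL c.2
      exact ih m hm c.1.1 c.1.2 h₂ h₁
    choose T hT using hchild
    obtain ⟨c, hc, -⟩ := exists_mem_succ hQ hI hS hl hL γ hm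
    exact ⟨.node S A γ t.inp ⟨c, hc⟩ T, hT⟩

/-- With the letter and the top symbol fixed, determinism makes a transition recoverable from its
source. The sources of the moves are therefore distinct members of `L`. -/
theorem length_moves_toRaw_le (hQ : fQ.Injective) (hI : fI.Injective) (hS : fS.Injective)
    (hdet : P.Deterministic) (hnodup : l.Nodup) (hl : ∀ t, t ∈ l ↔ t ∈ P.δ) (L : List ℕ) (a A : ℕ) :
    (moves (l.map (Transition.toRaw fQ fI fS)) L a A).length ≤ L.length := by
  rw [← List.length_map (fun t : RawTransition => t.src)]
  refine (List.Nodup.subperm (List.Nodup.map_on ?_ ((hnodup.map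
    (Transition.toRaw_injective hQ hI hS)).filter _)) fun i hi => ?_).length_le
  · intro u hu v hv huv
    obtain ⟨hu, -, hu₁, hu₂⟩ := mem_moves.1 hu
    obtain ⟨hv, -, hv₁, hv₂⟩ := mem_moves.1 hv
    obtain ⟨t, ht, rfl⟩ := List.mem_map.1 hu
    obtain ⟨t', ht', rfl⟩ := List.mem_map.1 hv
    rw [(hdet t.src t.inp t.top).unique ⟨(hl t).1 ht, rfl, rfl, rfl⟩ ⟨(hl t').1 ht', hQ huv.symm,
      hI (hv₁.trans hu₁.symm), hS (hv₂.trans hu₂.symm)⟩]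
  · obtain ⟨u, hu, rfl⟩ := List.mem_map.1 hi
    exact (mem_moves.1 hu).2.1

end

/-! ### Encoded instances -/

section

variable {x : DetInstance} {d : Data}

theorem DetInstance.two_le_size (x : DetInstance) : 2 ≤ x.P.size := by
  have h₁ : 0 < Fintype.card x.Q := Fintype.card_pos_iff.2 ⟨x.s⟩
  have h₂ : 0 < Fintype.card x.Stk := Fintype.card_pos_iff.2 ⟨x.P.bot⟩
  unfold PDA.size
  omega

theorem sz_toRaw_le {lI : List x.Q} {lδ : List (Transition x.Q x.Inp x.Stk)} (hI : lI.Nodup)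
    (hδ : lδ.Nodup) (hδ' : ∀ t, t ∈ lδ ↔ t ∈ x.P.δ) (nQ : x.Q ≃ Fin (Fintype.card x.Q))
    (nInp : x.Inp ≃ Fin (Fintype.card x.Inp)) (nStk : x.Stk ≃ Fin (Fintype.card x.Stk)) :
    sz (lI.map fun q => (nQ q : ℕ), (nQ x.s : ℕ), (nStk x.P.bot : ℕ), Fintype.card x.Q,
      Fintype.card x.Inp, Fintype.card x.Stk, lδ.map (Transition.toRaw (fun q => (nQ q : ℕ))
        (fun a => (nInp a : ℕ)) fun A => (nStk A : ℕ)), ()) ≤ x.P.size ^ 6 := by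
  classical
  have hn := x.two_le_size
  have h₁ : 0 < Fintype.card x.Q := Fintype.card_pos_iff.2 ⟨x.s⟩
  have h₂ : 0 < Fintype.card x.Stk := Fintype.card_pos_iff.2 ⟨x.P.bot⟩
  have hsum : (lδ.map fun t => 4 + t.push.length).sum = ∑ t ∈ x.P.δ, (4 + t.push.length) := by
    rw [← List.sum_toFinset _ hδ]
    exact Finset.sum_congr (by ext t; simp [hδ']) fun _ _ => rfl
  have hsize : Fintype.card x.Q + Fintype.card x.Inp + Fintype.card x.Stk +
    (lδ.map fun t => 4 + t.push.length).sum = x.P.size := by rw [hsum]; rfl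
  generalize x.P.size = n at hn hsize ⊢
  have hQ : ∀ q, sz (nQ q : ℕ) ≤ 2 * n := fun q => by rw [sz_nat]; have := (nQ q).2; omega
  have hInp : ∀ q, sz (nInp q : ℕ) ≤ 2 * n := fun q => by rw [sz_nat]; have := (nInp q).2; omega
  have hStk : ∀ q, sz (nStk q : ℕ) ≤ 2 * n := fun q => by rw [sz_nat]; have := (nStk q).2; omega
  have hlen : lI.length ≤ n := hI.length_le_card.trans (by omega)
  have hlI : sz (lI.map fun q => (nQ q : ℕ)) ≤ 2 + n * (2 * n) :=
    sz_le_of_forall (by simpa using hlen) (by simpa using fun q _ => hQ q)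
  have ht : ∀ t : Transition x.Q x.Inp x.Stk, sz (t.toRaw (fun q => (nQ q : ℕ))
      (fun a => (nInp a : ℕ)) fun A => (nStk A : ℕ)) ≤ (2 * n + 1) * (4 + t.push.length) := by
    intro t
    have h₃ : sz (t.push.map fun A => (nStk A : ℕ)) ≤ 2 + t.push.length * (2 * n) :=
      sz_le_of_forall (by simp) (by simpa using fun q _ => hStk q)
    have h₄ : sz () = 2 := rfl
    have := hQ t.src
    have := hInp t.inp
    have := hStk t.top
    have := hQ t.tgt
    simp only [Transition.toRaw, sz_pair]
    nlinarith
  have hδs : sz (lδ.map (Transition.toRaw (fun q => (nQ q : ℕ))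
      (fun a => (nInp a : ℕ)) fun A => (nStk A : ℕ))) ≤ 2 + (2 * n + 1) * n := by
    rw [sz_list, List.map_map]
    have h₃ := List.sum_le_sum (l := lδ) fun t _ => ht t
    rw [List.sum_map_mul_left] at h₃
    have h₄ : (2 * n + 1) * (lδ.map fun t => 4 + t.push.length).sum ≤ (2 * n + 1) * n :=
      Nat.mul_le_mul_left _ (by omega)
    exact Nat.add_le_add_left (h₃.trans h₄) 2
  have hc₁ : sz (Fintype.card x.Q) ≤ 2 * n := by rw [sz_nat]; omega
  have hc₂ : sz (Fintype.card x.Inp) ≤ 2 * n := by rw [sz_nat]; omega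
  have hc₃ : sz (Fintype.card x.Stk) ≤ 2 * n := by rw [sz_nat]; omega
  have h₄ : sz () = 2 := rfl
  have h₅ := hQ x.s
  have h₆ := hStk x.P.bot
  -- The total is quadratic and at most `16 * n ^ 2`, which `n ≥ 2` turns into a pure power without
  -- a constant.
  have h₇ : 2 ^ 4 ≤ n ^ 4 := Nat.pow_le_pow_left hn 4
  have h₈ : n ^ 6 = n ^ 2 * n ^ 4 := by ring
  have h₉ : n ^ 2 * 2 ^ 4 ≤ n ^ 2 * n ^ 4 := Nat.mul_le_mul_left _ h₇
  simp only [sz_pair]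
  nlinarith

theorem DetInstance.Encodes.exists_raw (h : x.Encodes d) : ∃ r : RawInstance, d = Enc.enc r ∧
    r.init.length = x.I.card ∧ (r.init ≠ [] → (r.answer ↔ x.P.SuperSync x.I [x.P.bot] x.s)) ∧
    sz r ≤ x.P.size ^ 6 := by
  obtain ⟨nQ, nInp, nStk, lI, lδ, hI, hI', hδ, hδ', rfl⟩ := h
  let fQ : x.Q → ℕ := fun q => nQ q
  let fI : x.Inp → ℕ := fun q => nInp q
  let fS : x.Stk → ℕ := fun q => nStk q
  have hfQ : fQ.Injective := Fin.val_injective.comp nQ.injective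
  have hfI : fI.Injective := Fin.val_injective.comp nInp.injective
  have hfS : fS.Injective := Fin.val_injective.comp nStk.injective
  refine ⟨(lI.map fQ, fQ x.s, fS x.P.bot, Fintype.card x.Q, Fintype.card x.Inp, Fintype.card x.Stk,
    lδ.map (Transition.toRaw fQ fI fS), ()), ?_, ?_, fun hne => ?_, ?_⟩
  · have hlist : ∀ {α : Type} [Enc α] (l : List α), Enc.enc l = Data.ofList (l.map Enc.enc) :=
      fun _ => rfl
    have hnat : ∀ n : ℕ, Enc.enc n = Data.ofNat n := fun _ => rfl
    -- The trailing `()` of the raw tuples is encoded by `nil`, so nested pairs have the same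
    -- encoding as the lists of components prescribed for inputs.
    simp only [enc_pair, hlist, hnat, Data.ofList, List.map_map, Function.comp_def,
      Transition.toRaw, fQ, fI, fS]
    rfl
  · classical
    rw [List.length_map, ← List.toFinset_card_of_nodup hI]
    exact congrArg Finset.card (by ext q; simp [hI'])
  · rw [RawInstance.answer_iff (length_moves_toRaw_le hfQ hfI hfS x.det hδ hδ') ?_ hne]
    · have hrep : Represents fQ (x.I : Set x.Q) (lI.map fQ) := fun i => by
        simp [hI']
      exact ⟨fun h => superSync_of_force hfQ hfI hfS hδ' h _ _ rfl hrep,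
        fun ⟨T, hT⟩ => force_of_isSuper hfQ hfI hfS hδ' T hT _ hrep⟩
    · intro t ht htop
      obtain ⟨t, hmem, rfl⟩ := List.mem_map.1 ht
      obtain ⟨γ, hγ⟩ := x.P.bot_push t ((hδ' t).1 hmem) (hfS htop)
      exact ⟨γ.map fS, by simp [Transition.toRaw, hγ]⟩
  · exact sz_toRaw_le hI hδ hδ' nQ nInp nStk

end

/-! ## The main theorem -/

/-- This settles `I = ∅`: no synchroniser starts from empty knowledge. -/
theorem PDA.Synchroniser.nonempty {Q Inp Stk : Type} {P : PDA Q Inp Stk} {s : Q}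
    {c : PDA.PseudoConf Q Stk} (T : P.Synchroniser s c) : c.1.Nonempty := by
  cases T with
  | leaf η => exact Set.singleton_nonempty s
  | node S A η a hne child =>
    obtain ⟨c, hc⟩ := hne
    obtain ⟨t, ht, -⟩ := PDA.mem_succ_iff.1 hc
    exact ⟨_, ht.2.1⟩

theorem exists_prog : ∃ (p : Prog) (c : ℕ), ∀ (x : DetInstance) (d : Data), x.Encodes d →
    ∃ (σ : Store) (t : ℕ), Run p (inputStore d) σ t ∧ t ≤ 5 * x.P.size ^ (4 * c * x.I.card ^ 3) ∧
      (σ 0 ≠ Data.nil ↔ x.P.SuperSync (x.I : Set x.Q) [x.P.bot] x.s) := by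
  obtain ⟨-, T, hT, c, hc⟩ := RawInstance.polyTimeIn_answer
  obtain ⟨p, hp⟩ := hT 0
  -- For `k = 0` the bound is a constant, so emptiness of `I` is tested before anything else. The
  -- factor 25 is the value of `6 * (k + 1) ^ 2 + 1` at `k = 1`, and `6 * (k + 1) ^ 2 + 1 ≤ 25 * k ^
  -- 3` for all `k ≥ 1`.
  refine ⟨.ite (.hd (.var 0)) p (.assign 0 .nil), 25 * c, fun x d hd => ?_⟩
  obtain ⟨r, rfl, hk, hans, hsz⟩ := hd.exists_raw
  have hn := x.two_le_size
  set n := x.P.size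
  have hval : (Expr.hd (.var 0)).eval (inputStore (Enc.enc r)) = Enc.enc r.init := rfl
  have hX : 1 ≤ n ^ (4 * (25 * c) * x.I.card ^ 3) := Nat.one_le_pow _ _ (by omega)
  by_cases hr : r.init = []
  · have hI : x.I = ∅ := by rw [← Finset.card_eq_zero, ← hk, hr, List.length_nil]
    refine ⟨_, _, .ite_false (by rw [hval, hr]; rfl) (.assign _ _ _), ?_, ?_⟩
    -- Three steps for the test and two for the assignment: this is the constant 5.
    · simp only [Expr.cost]
      omega
    · simp only [Function.update_self, Expr.eval, ne_eq, not_true_eq_false, false_iff, hI,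
        Finset.coe_empty]
      exact fun ⟨T, _⟩ => Set.not_nonempty_empty T.nonempty
  · obtain ⟨σ, t, hrun, ⟨hσ, -⟩, ht⟩ := hp (inputStore (Enc.enc r)) r rfl
    refine ⟨σ, _, .ite_true ?_ hrun, ?_, ?_⟩
    · rw [hval]
      cases hi : r.init with
      | nil => exact absurd hi hr
      | cons i l => exact Data.noConfusion
    · have hk1 : 1 ≤ x.I.card := hk ▸ List.length_pos_of_ne_nil hr
      have h2 := two_le_sz r
      have h₁ : r.measure + sz r ≤ n ^ (25 * x.I.card ^ 3) :=
        calc r.measure + sz r ≤ sz r ^ (x.I.card + 1) ^ 2 * 2 := by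
              have := Nat.le_self_pow (n := (x.I.card + 1) ^ 2) (by positivity) (sz r)
              rw [RawInstance.measure, hk]
              omega
          _ ≤ (n ^ 6) ^ (x.I.card + 1) ^ 2 * n :=
              Nat.mul_le_mul (Nat.pow_le_pow_left hsz _) hn
          _ = n ^ (6 * (x.I.card + 1) ^ 2 + 1) := by rw [← pow_mul, ← pow_succ]
          _ ≤ n ^ (25 * x.I.card ^ 3) := by
              refine Nat.pow_le_pow_right (by omega) ?_
              generalize x.I.card = k at hk1
              obtain ⟨k, rfl⟩ := Nat.exists_eq_add_of_le hk1
              ring_nf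
              nlinarith [Nat.zero_le k]
      have h₃ : T r ≤ n ^ (4 * (25 * c) * x.I.card ^ 3) := by
        refine (hc r).trans ((Nat.pow_le_pow_left h₁ c).trans ?_)
        rw [← pow_mul]
        exact Nat.pow_le_pow_right (by omega) (by nlinarith [Nat.zero_le (c * x.I.card ^ 3)])
      simp only [Expr.cost]
      omega
    · rw [hσ, enc_bool_ne_nil, hans hr]

/-- With `y = log n ≥ 1` and `k ≤ m * y`, the exponent of 2 is at most `3 + 4 * c * m ^ 3 * y ^ 4`.
The 3 absorbs the factor 5, and `|b|` is used because `b` may be negative. -/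
theorem mul_pow_le_two_rpow {n k c : ℕ} (hn : 2 ≤ n) {b : ℝ} (hk : (k : ℝ) ≤ b * Real.logb 2 n) :
    (5 : ℝ) * (n : ℝ) ^ (4 * c * k ^ 3) ≤
      (2 : ℝ) ^ (((3 + 4 * c * ⌈|b|⌉₊ ^ 3 : ℕ) : ℝ) * Real.logb 2 n ^ 4) := by
  have hn' : (2 : ℝ) ≤ n := by exact_mod_cast hn
  have hlog : 1 ≤ Real.logb 2 n := by
    rw [Real.le_logb_iff_rpow_le (by norm_num) (by linarith)]
    simpa using hn'
  have hn₂ : (n : ℝ) = 2 ^ Real.logb 2 n :=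
    (Real.rpow_logb (by norm_num) (by norm_num) (by linarith)).symm
  set y := Real.logb 2 n
  set m := ⌈|b|⌉₊
  have hk' : (k : ℝ) ≤ m * y := hk.trans
    (mul_le_mul_of_nonneg_right ((le_abs_self b).trans (Nat.le_ceil _)) (by linarith))
  have hk₃ : (k : ℝ) ^ 3 ≤ m ^ 3 * y ^ 3 := by
    rw [← mul_pow]
    exact pow_le_pow_left₀ (Nat.cast_nonneg k) hk' 3
  have hpow : (n : ℝ) ^ (4 * c * k ^ 3) = 2 ^ (y * (4 * c * k ^ 3 : ℕ)) := by
    rw [Real.rpow_mul (by norm_num), ← hn₂, Real.rpow_natCast]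
  calc (5 : ℝ) * (n : ℝ) ^ (4 * c * k ^ 3) ≤ 2 ^ (3 : ℝ) * 2 ^ (y * (4 * c * k ^ 3 : ℕ)) := by
        rw [hpow]
        exact mul_le_mul_of_nonneg_right (by norm_num) (by positivity)
    _ = 2 ^ (3 + y * (4 * c * k ^ 3 : ℕ)) := (Real.rpow_add (by norm_num) _ _).symm
    _ ≤ _ := by
        refine Real.rpow_le_rpow_of_exponent_le (by norm_num) ?_
        have h₁ : 1 ≤ y ^ 4 := one_le_pow₀ hlog
        have h₂ : y * (4 * c * k ^ 3) ≤ y * (4 * c * (m ^ 3 * y ^ 3)) := by gcongr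
        push_cast
        nlinarith

/-- A single program decides the problem: in time `O(n ^ (4 c k ^ 3))` for a fixed constant `c`,
hence in polynomial time on the instances with `k` fixed, and in quasi-polynomial time on the
instances with `k = O(log n)`, where `n = |P|` and `k = |I|`. -/
theorem mainTheorem4 :
    ∃ p : Prog,
      (∃ c C : ℕ, ∀ x : DetInstance,
        x.DecidedWithin p ((C : ℝ) * (x.P.size : ℝ) ^ (4 * c * x.I.card ^ 3))) ∧
      (∀ k : ℕ, ∃ e C : ℕ, ∀ x : DetInstance, x.I.card = k →
        x.DecidedWithin p ((C : ℝ) * (x.P.size : ℝ) ^ e)) ∧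
      (∀ b : ℝ, ∃ e C : ℕ, ∀ x : DetInstance, (x.I.card : ℝ) ≤ b * Real.logb 2 x.P.size →
        x.DecidedWithin p ((2 : ℝ) ^ ((C : ℝ) * Real.logb 2 x.P.size ^ e))) := by
  obtain ⟨p, c, h⟩ := exists_prog
  have h₁ : ∀ x : DetInstance,
      x.DecidedWithin p (((5 : ℕ) : ℝ) * (x.P.size : ℝ) ^ (4 * c * x.I.card ^ 3)) := by
    intro x d hd
    obtain ⟨σ, t, hrun, ht, hσ⟩ := h x d hd
    exact ⟨σ, t, hrun, by exact_mod_cast ht, hσ⟩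
  refine ⟨p, ⟨c, 5, h₁⟩, fun k => ⟨4 * c * k ^ 3, 5, fun x hx => hx ▸ h₁ x⟩,
    fun b => ⟨4, 3 + 4 * c * ⌈|b|⌉₊ ^ 3, fun x hx d hd => ?_⟩⟩
  obtain ⟨σ, t, hrun, ht, hσ⟩ := h₁ x d hd
  exact ⟨σ, t, hrun, ht.trans (mul_pow_le_two_rpow x.two_le_size hx), hσ⟩
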